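/- Let $\mathbb K\in\{\mathbb R,\mathbb C\}$. For a Banach space $X$ over $\mathbb K$, a set $L\subset X^*$ and $\varepsilon>0$, let $s_\varepsilon(L)$ be the set of those $x^*\in L$ such that $\operatorname{diam}(L\cap V)>\varepsilon$ (norm diameter) for every $w^*$-neighborhood $V$ of $x^*$. Put $s^0_\varepsilon(L)=L$, $s_\varepsilon^{\xi+1}(L)=s_\varepsilon(s_\varepsilon^\xi(L))$, and $s_\varepsilon^\xi(L)=\bigcap_{\zeta<\xi}s_\varepsilon^\zeta(L)$ for limit ordinals $\xi$. Let $Sz(L,\varepsilon)$ be the least ordinal $\xi$ with $s_\varepsilon^\xi(L)=\varnothing$, if one exists, and $Sz(L,\varepsilon)=\infty$ otherwise; let $Sz(L)=\sup_{\varepsilon>0}Sz(L,\varepsilon)$, with the conventions $\xi<\infty$ for every ordinal $\xi$ and $\omega\infty=\infty$. For a (bounded linear) operator $A:X\to Y$ between Banach spaces put $Sz(A)=Sz(A^*B_{Y^*})$, where $B_{Y^*}$ is the closed unit ball of $Y^*$, and put $Sz(X)=Sz(I_X)$. The operator $A$ is called Asplund if $A^*B_{Y^*}$ is $w^*$-fragmentable,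 that is, $s_\varepsilon(M)\subsetneq M$ for every $\varepsilon>0$ and every non-empty $w^*$-compact $M\subset A^*B_{Y^*}$. For $1<p<\infty$ let $L_p(X)$ be the Bochner space $L_p([0,1];X)$ with respect to Lebesgue measure, and let $A_p:L_p(X)\to L_p(Y)$ be given by $(A_pf)(\varpi)=A(f(\varpi))$. Let $1<p<\infty$ and let $A:X\to Y$ be an operator between Banach spaces. Then $Sz(A_p)\leq \omega\, Sz(A)$, and if $Sz(A)\geq\omega^\omega$, then $Sz(A_p)=Sz(A)$. Moreover, $A_p$ is Asplund if and only if $A$ is Asplund. In particular, for every Banach space $X$, $Sz(L_p(X))\leq\omega\, Sz(X)$, and if $Sz(X)\geq\omega^\omega$, then $Sz(L_p(X))=Sz(X)$. -/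

import Mathlib

open MeasureTheory Topology
open scoped ENNReal Ordinal

universe u v

namespace Szlenk

noncomputable section

variable {𝕜 : Type} [RCLike 𝕜]
variable {X : Type u} [NormedAddCommGroup X] [NormedSpace 𝕜 X]
variable {Y : Type v} [NormedAddCommGroup Y] [NormedSpace 𝕜 Y]

/-- The Szlenk derivation `s_ε(L)`: the points `x` of `L ⊆ X*` such that every weak-star
neighbourhood `V` of `x` satisfies `diam (L ∩ V) > ε`, the diameter being that of the dual norm. -/
def derivation (ε : ℝ) (L : Set (StrongDual 𝕜 X)) : Set (StrongDual 𝕜 X) :=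
  {x | x ∈ L ∧ ∀ V ∈ 𝓝 (StrongDual.toWeakDual x),
    ENNReal.ofReal ε < Metric.ediam (L ∩ StrongDual.toWeakDual ⁻¹' V)}

/-- The transfinite iterates `s_ε^ξ(L)`: `s_ε^0(L) = L`, `s_ε^(ξ+1)(L) = s_ε(s_ε^ξ(L))`, and
intersections at limit ordinals. -/
def iterDerivation (ε : ℝ) (L : Set (StrongDual 𝕜 X)) (ξ : Ordinal.{u}) :
    Set (StrongDual 𝕜 X) :=
  Ordinal.limitRecOn ξ L (fun _ S => derivation ε S) (fun o _ S => ⋂ (ζ) (hζ : ζ < o), S ζ hζ)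

/-- `Sz(L, ε)`: the least ordinal `ξ` with `s_ε^ξ(L) = ∅`, and `⊤` (that is, `∞`) if there is
none. -/
def indexEps (L : Set (StrongDual 𝕜 X)) (ε : ℝ) : WithTop Ordinal.{u} :=
  sInf ((fun ξ : Ordinal.{u} => (ξ : WithTop Ordinal.{u})) '' {ξ | iterDerivation ε L ξ = ∅})

/-- The Szlenk index of a set, `Sz(L) = sup_{ε > 0} Sz(L, ε)`. -/
def index (L : Set (StrongDual 𝕜 X)) : WithTop Ordinal.{u} :=
  ⨆ (ε : ℝ) (_ : 0 < ε), indexEps L ε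

/-- The set `A^* B_{Y^*} ⊆ X^*`, the image of the closed dual unit ball under the adjoint. -/
def adjointBall (A : X →L[𝕜] Y) : Set (StrongDual 𝕜 X) :=
  (fun y : StrongDual 𝕜 Y => y.comp A) '' Metric.closedBall 0 1

/-- The Szlenk index of an operator, `Sz(A) = Sz(A^* B_{Y^*})`. -/
def opIndex (A : X →L[𝕜] Y) : WithTop Ordinal.{u} := index (adjointBall A)

/-- The Szlenk index of a space, `Sz(X) = Sz(I_X)`. -/
def spaceIndex (𝕜 : Type) [RCLike 𝕜] (X : Type u) [NormedAddCommGroup X] [NormedSpace 𝕜 X] :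
    WithTop Ordinal.{u} :=
  opIndex (ContinuousLinearMap.id 𝕜 X)

/-- `ω · a` for an ordinal `a` or `a = ∞`, with `ω · ∞ = ∞`. -/
def omegaMul (a : WithTop Ordinal.{u}) : WithTop Ordinal.{u} := a.map (fun ξ => ω * ξ)

/-- Weak-star fragmentability of `L ⊆ X*`: for every `ε > 0` and every nonempty weak-star compact
`M ⊆ L`, the set `s_ε(M)` is a proper subset of `M`. -/
def IsFragmentable (L : Set (StrongDual 𝕜 X)) : Prop :=
  ∀ ε : ℝ, 0 < ε → ∀ M : Set (StrongDual 𝕜 X), M ⊆ L → M.Nonempty →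
    IsCompact (StrongDual.toWeakDual '' M) → derivation ε M ⊂ M

/-- An operator `A` is Asplund if `A^* B_{Y^*}` is weak-star fragmentable. -/
def IsAsplund (A : X →L[𝕜] Y) : Prop := IsFragmentable (adjointBall A)

/-- The Bochner space `L_p(X) = L_p([0,1]; X)` for Lebesgue measure on `[0,1]`. -/
abbrev LpSpace (p : ℝ≥0∞) (X : Type u) [NormedAddCommGroup X] : Type u :=
  Lp X p (volume : Measure unitInterval)

/-- The pointwise operator `A_p : L_p(X) → L_p(Y)`, `(A_p f)(t) = A (f t)`. -/
abbrev pointwiseOp (p : ℝ≥0∞) [Fact (1 ≤ p)] (A : X →L[𝕜] Y) : LpSpace p X →L[𝕜] LpSpace p Y :=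
  ContinuousLinearMap.compLpL p (volume : Measure unitInterval) A

end

end Szlenk

/-!
The functionals in `A_p^* B` are barycentres of positive functionals of norm at most one on
`L_p(ℓ_∞(B))`, where `B` is the dual unit ball of `Y` as a discrete set
(`adjointBall_pointwiseOp_subset`); these stand in for weak-star measurable densities with
values in the positive measures on `A^* B`, but need neither measurability nor separability. They
form a weak-star compact set `PosBall`, and Szlenk derivations of its image lift to derivations of
`PosBall` along the barycentre map (`iterDerivation_image_subset`). A positive functional together
with a weight in `L_p` is a finitely additive content on `A^* B`.

Fix a scale `δ` and let `level ξ` be the `ξ`-th Szlenk derivate of `A^* B`. Suppose the contents of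
a set of functionals concentrate near a compact set that is locally of diameter at most `δ`. Then
the barycentres are determined up to a small error by finitely many coordinates in the dual of
`L_p`, and since `L_p` is uniformly smooth, finitely many derivations exhaust the set
(`exists_iter_of_concentrated`, `exists_iter_derivationAlong_eq_empty`). By compactness, `ω`
derivations suffice when most of the mass is known to lie in finitely many differences
`level ζ \ level (ζ + 1)`. An induction on `γ` shows that `ω * ω ^ γ` derivations suffice when it
lies in finitely many differences `level ζ \ level (ζ + ω ^ γ)` (`iter_of_isPinned_opow`): such a
block is cut into finitely many shorter blocks, and the outer contents at the cuts can move only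
finitely often by more than a fixed amount.

If `level (ω ^ a)` is empty and `a ≠ 0`, then `level (ω ^ c * n)` is empty for some `c < a`, and all
the mass lies in that one block. A functional that nearly attains the largest norm of the marginal
on `L_p` puts little mass off the set that carries its content, because the `p`-th powers of norms
of disjoint functions add up, so the previous paragraph applies: fewer than `ω * ω ^ a` derivations
lower the norm of the marginal by a fixed amount, and finitely many such rounds exhaust `PosBall`
(`iter_posBall_eq_empty`).

Convexity makes the Szlenk index of an operator additively principal, hence of the form `ω ^ a` or
infinite (`exists_opIndex_eq_opow`), which gives `Sz(A_p) ≤ ω Sz(A)`. The transpose of the mean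
`L_p(X) → X` does not shrink distances and maps `A^* B` into `A_p^* B`, so `Sz(A) ≤ Sz(A_p)`.
Finally `ω * ω ^ a = ω ^ a` as soon as `ω ≤ a`, and an operator is Asplund exactly when its index is
not infinite (`isAsplund_iff`).
-/

namespace Szlenk

set_option linter.unusedSectionVars false

open Set

/-! ### Transfinite iteration of a set operator -/

section Iteration

universe w

variable {α β : Type*}

/-- The transfinite iterates of an operator `d` on sets, started at `L`, with intersections at
limit ordinals. -/
noncomputable def iter (d : Set α → Set α) (L : Set α) (ξ : Ordinal.{w}) : Set α :=
  Ordinal.limitRecOn ξ L (fun _ S => d S) (fun o _ S => ⋂ (ζ) (hζ : ζ < o), S ζ hζ)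

variable (d : Set α → Set α) (L : Set α)

@[simp]
theorem iter_zero : iter d L (0 : Ordinal.{w}) = L := by simp [iter]

@[simp]
theorem iter_add_one (ξ : Ordinal.{w}) : iter d L (ξ + 1) = d (iter d L ξ) := by simp [iter]

theorem iter_limit {ξ : Ordinal.{w}} (h : Order.IsSuccLimit ξ) :
    iter d L ξ = ⋂ ζ < ξ, iter d L ζ := by
  simp only [iter]
  rw [Ordinal.limitRecOn_limit (h := h)]

variable {d L}

theorem iter_mapsTo {d' : Set β → Set β} {L' : Set β} {f : α → β}
    (h : ∀ S S', MapsTo f S S' → MapsTo f (d S) (d' S')) (hL : MapsTo f L L') (ξ : Ordinal.{w}) :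
    MapsTo f (iter d L ξ) (iter d' L' ξ) := by
  induction ξ using Ordinal.limitRecOn with
  | zero => simpa using hL
  | add_one ξ ih => simpa using h _ _ ih
  | limit ξ hξ ih =>
    rw [iter_limit _ _ hξ, iter_limit _ _ hξ]
    exact fun x hx => mem_iInter₂.2 fun ζ hζ => ih ζ hζ (mem_iInter₂.1 hx ζ hζ)

theorem iter_mono (hd : Monotone d) {L' : Set α} (hL : L ⊆ L') (ξ : Ordinal.{w}) :
    iter d L ξ ⊆ iter d L' ξ :=
  iter_mapsTo (f := id) (fun _ _ h => hd h) hL ξ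

theorem iter_antitone (hd : ∀ S, d S ⊆ S) {ξ ζ : Ordinal.{w}} (h : ξ ≤ ζ) :
    iter d L ζ ⊆ iter d L ξ := by
  induction ζ using Ordinal.limitRecOn with
  | zero => simp [le_antisymm h zero_le]
  | add_one ζ ih =>
    rcases h.eq_or_lt with rfl | h
    · rfl
    · simpa using (hd _).trans (ih (Order.lt_add_one_iff.1 h))
  | limit ζ hζ ih =>
    rcases h.eq_or_lt with rfl | h
    · rfl
    · rw [iter_limit _ _ hζ]
      exact biInter_subset_of_mem h

theorem iter_subset (hd : ∀ S, d S ⊆ S) (ξ : Ordinal.{w}) : iter d L ξ ⊆ L := by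
  simpa using iter_antitone (L := L) hd (zero_le (a := ξ))

theorem iter_add (hd : ∀ S, d S ⊆ S) (ξ ζ : Ordinal.{w}) :
    iter d L (ξ + ζ) = iter d (iter d L ξ) ζ := by
  induction ζ using Ordinal.limitRecOn with
  | zero => simp
  | add_one ζ ih => rw [← add_assoc, iter_add_one, ih, iter_add_one]
  | limit ζ hζ ih =>
    rw [iter_limit _ _ hζ, iter_limit _ _ (Ordinal.isSuccLimit_add ξ hζ)]
    refine Subset.antisymm (fun x hx => mem_iInter₂.2 fun η hη => ?_)
      (fun x hx => mem_iInter₂.2 fun η hη => ?_)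
    · rw [← ih η hη]
      exact mem_iInter₂.1 hx _ (by gcongr)
    · obtain ⟨c, hc, h⟩ := (Ordinal.lt_add_iff hζ.ne_bot).1 hη
      have := mem_iInter₂.1 hx c hc
      rw [← ih c hc] at this
      exact iter_antitone hd h this

/-- If `ξ` iterations push each `S n` into `S (n + 1)`, then `ξ * n` iterations push `S 0` into
`S n`. -/
theorem iter_mul_nat (hd : ∀ S, d S ⊆ S) (hm : Monotone d) {S : ℕ → Set α} {ξ : Ordinal.{w}}
    (h : ∀ n, iter d (S n) ξ ⊆ S (n + 1)) (n : ℕ) : iter d (S 0) (ξ * n) ⊆ S n := by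
  induction n with
  | zero => simp
  | succ n ih =>
    rw [Nat.cast_add_one, mul_add_one, iter_add hd]
    exact (iter_mono hm ih ξ).trans (h n)

theorem iter_inter_subset {U : Set α} (hd : Monotone d) (h : ∀ S, d S ∩ U ⊆ d (S ∩ U))
    (ξ : Ordinal.{w}) : iter d L ξ ∩ U ⊆ iter d (L ∩ U) ξ := by
  induction ξ using Ordinal.limitRecOn with
  | zero => simp
  | add_one ξ ih => simpa using (h _).trans (hd ih)
  | limit ξ hξ ih =>
    rw [iter_limit _ _ hξ, iter_limit _ _ hξ]
    exact fun x hx => mem_iInter₂.2 fun ζ hζ => ih ζ hζ ⟨mem_iInter₂.1 hx.1 ζ hζ, hx.2⟩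

theorem iter_inter_isOpen [TopologicalSpace α] (hd : Monotone d)
    (h : ∀ S U, IsOpen U → d S ∩ U ⊆ d (S ∩ U)) {U : Set α} (hU : IsOpen U) (ξ : Ordinal.{w}) :
    iter d L ξ ∩ U ⊆ iter d (L ∩ U) ξ :=
  iter_inter_subset hd (fun S => h S U hU) ξ

theorem iter_isClosed [TopologicalSpace α] (h : ∀ S, IsClosed S → IsClosed (d S))
    (hL : IsClosed L) (ξ : Ordinal.{w}) : IsClosed (iter d L ξ) := by
  induction ξ using Ordinal.limitRecOn with
  | zero => simpa
  | add_one ξ ih => simpa using h _ ih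
  | limit ξ hξ ih =>
    rw [iter_limit _ _ hξ]
    exact isClosed_biInter ih

/-- In a compact closed set, an intersection of iterates at a limit ordinal that lies in an open
set `O` is reached before the limit. -/
theorem exists_iter_subset_of_limit [TopologicalSpace α] (hd : ∀ S, d S ⊆ S)
    (hcl : ∀ S, IsClosed S → IsClosed (d S)) (hc : IsCompact L) (hL : IsClosed L)
    {ξ : Ordinal.{w}} (hξ : Order.IsSuccLimit ξ) {O : Set α} (hO : IsOpen O)
    (h : iter d L ξ ⊆ O) : ∃ ζ < ξ, iter d L ζ ⊆ O := by
  by_contra! hcon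
  have : Nonempty (Iio ξ) := ⟨⟨0, hξ.bot_lt⟩⟩
  have := IsCompact.nonempty_iInter_of_directed_nonempty_isCompact_isClosed
    (fun ζ : Iio ξ => iter d L ζ.1 ∩ Oᶜ) ?_ ?_ ?_ ?_
  · obtain ⟨x, hx⟩ := this
    rw [mem_iInter] at hx
    refine (hx ⟨0, hξ.bot_lt⟩).2 (h ?_)
    rw [iter_limit _ _ hξ]
    exact mem_iInter₂.2 fun ζ hζ => (hx ⟨ζ, hζ⟩).1
  · refine directed_of_isDirected_le fun a b hab => ?_
    exact inter_subset_inter_left _ (iter_antitone hd hab)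
  · intro ζ
    obtain ⟨x, hx, hxO⟩ := not_subset.1 (hcon ζ.1 ζ.2)
    exact ⟨x, hx, hxO⟩
  · exact fun ζ => hc.of_isClosed_subset ((iter_isClosed hcl hL _).inter hO.isClosed_compl)
      (inter_subset_left.trans (iter_subset hd _))
  · exact fun ζ => (iter_isClosed hcl hL _).inter hO.isClosed_compl

end Iteration

/-! ### Derivations along a map -/

section DerivationAlong

variable {P Z : Type*} [TopologicalSpace P] [PseudoEMetricSpace Z]

/-- The derivation of subsets of a topological space `P` whose diameters are measured in `Z` through
a map `q : P → Z`: the points of `D` all of whose neighbourhoods `V` satisfy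
`diam (q (D ∩ V)) > ε`. -/
def derivationAlong (q : P → Z) (ε : ℝ) (D : Set P) : Set P :=
  {x | x ∈ D ∧ ∀ V ∈ 𝓝 x, ENNReal.ofReal ε < Metric.ediam (q '' (D ∩ V))}

variable (q : P → Z) (ε : ℝ)

theorem derivationAlong_subset (D : Set P) : derivationAlong q ε D ⊆ D := fun _ h => h.1

theorem derivationAlong_mono : Monotone (derivationAlong q ε) := fun _ _ h _ hx =>
  ⟨h hx.1, fun V hV => (hx.2 V hV).trans_le
    (Metric.ediam_mono (image_mono (inter_subset_inter_left V h)))⟩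

theorem derivationAlong_inter (D U : Set P) (hU : IsOpen U) :
    derivationAlong q ε D ∩ U ⊆ derivationAlong q ε (D ∩ U) := fun x hx =>
  ⟨⟨hx.1.1, hx.2⟩, fun V hV => by
    have := hx.1.2 (U ∩ V) (Filter.inter_mem (hU.mem_nhds hx.2) hV)
    rwa [← inter_assoc] at this⟩

theorem derivationAlong_isClosed (D : Set P) (hD : IsClosed D) :
    IsClosed (derivationAlong q ε D) := by
  rw [← isOpen_compl_iff, isOpen_iff_mem_nhds]
  intro x hx
  by_cases hxD : x ∈ D
  · have : ∃ V ∈ 𝓝 x, Metric.ediam (q '' (D ∩ V)) ≤ ENNReal.ofReal ε := by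
      by_contra! h
      exact hx ⟨hxD, h⟩
    obtain ⟨V, hV, hd⟩ := this
    filter_upwards [eventually_mem_nhds_iff.2 hV] with y hy h
    exact absurd (h.2 V hy) hd.not_gt
  · filter_upwards [hD.isOpen_compl.mem_nhds hxD] with y hy h
    exact hy h.1

end DerivationAlong

section Dual

variable {𝕜 : Type} [RCLike 𝕜]
variable {X : Type u} [NormedAddCommGroup X] [NormedSpace 𝕜 X]

theorem derivation_subset (ε : ℝ) (L : Set (StrongDual 𝕜 X)) : derivation ε L ⊆ L :=
  fun _ h => h.1

theorem derivation_mono (ε : ℝ) : Monotone (derivation (𝕜 := 𝕜) (X := X) ε) :=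
  fun _ _ h _ hx => ⟨h hx.1, fun V hV => (hx.2 V hV).trans_le
    (Metric.ediam_mono (inter_subset_inter_left _ h))⟩

theorem exists_dist_of_mem_derivation {ε : ℝ} {L : Set (StrongDual 𝕜 X)} {x : StrongDual 𝕜 X}
    (hx : x ∈ derivation ε L) {V : Set (WeakDual 𝕜 X)} (hV : V ∈ 𝓝 (StrongDual.toWeakDual x)) :
    ∃ y ∈ L, ∃ z ∈ L, StrongDual.toWeakDual y ∈ V ∧ StrongDual.toWeakDual z ∈ V ∧
      ENNReal.ofReal ε < edist y z := by
  by_contra! h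
  refine (hx.2 V hV).not_ge (Metric.ediam_le fun y hy z hz => ?_)
  exact h y hy.1 z hz.1 hy.2 hz.2

/-- A weak-star continuous map that shrinks distances at most by the factor `c` maps Szlenk
derivatives into Szlenk derivatives. -/
theorem iterDerivation_mapsTo {X' : Type*} [NormedAddCommGroup X'] [NormedSpace 𝕜 X']
    {T : StrongDual 𝕜 X → StrongDual 𝕜 X'} {T' : WeakDual 𝕜 X → WeakDual 𝕜 X'}
    (hT' : ∀ x, StrongDual.toWeakDual (T x) = T' (StrongDual.toWeakDual x)) (hT : Continuous T')
    {c : ℝ} (hc : 0 < c) (hTc : ∀ x y, c * dist x y ≤ dist (T x) (T y))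
    {L : Set (StrongDual 𝕜 X)} {L' : Set (StrongDual 𝕜 X')} (h : MapsTo T L L') (ε : ℝ)
    (ξ : Ordinal.{v}) :
    MapsTo T (iter (derivation ε) L ξ) (iter (derivation (c * ε)) L' ξ) := by
  refine iter_mapsTo ?_ h ξ
  intro S S' hS x hx
  refine ⟨hS hx.1, fun V hV => ?_⟩
  rw [hT'] at hV
  obtain ⟨y, hy, z, hz, hyV, hzV, hyz⟩ := exists_dist_of_mem_derivation hx (hT.continuousAt hV)
  calc ENNReal.ofReal (c * ε) = ENNReal.ofReal c * ENNReal.ofReal ε := ENNReal.ofReal_mul hc.le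
    _ < ENNReal.ofReal c * edist y z :=
      ENNReal.mul_lt_mul_right (by simpa using hc) ENNReal.ofReal_ne_top hyz
    _ ≤ edist (T y) (T z) := by
      rw [edist_dist, edist_dist, ← ENNReal.ofReal_mul hc.le]
      exact ENNReal.ofReal_le_ofReal (hTc y z)
    _ ≤ Metric.ediam (S' ∩ StrongDual.toWeakDual ⁻¹' V) := Metric.edist_le_ediam_of_mem
      (s := S' ∩ StrongDual.toWeakDual ⁻¹' V) ⟨hS hy, by rw [mem_preimage, hT']; exact hyV⟩
      ⟨hS hz, by rw [mem_preimage, hT']; exact hzV⟩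

/-- Szlenk derivatives of a weak-star continuous image of a compact space lift to the space. -/
theorem derivation_image_subset {P : Type*} [TopologicalSpace P] [CompactSpace P]
    {q : P → StrongDual 𝕜 X} (hq : Continuous fun ν => StrongDual.toWeakDual (q ν)) {ε : ℝ}
    (hε : 0 < ε) {D : Set P} (hD : IsClosed D) :
    derivation ε (q '' D) ⊆ q '' derivationAlong q (ε / 2) D := by
  intro x hx
  by_contra hcon
  set O : Set P := ⋃₀ {V | IsOpen V ∧ (∃ ν ∈ D ∩ V, q ν = x) ∧
    Metric.ediam (q '' (D ∩ V)) ≤ ENNReal.ofReal (ε / 2)} with hO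
  have hOo : IsOpen O := isOpen_sUnion fun V hV => hV.1
  have hfib : ∀ ν ∈ D, q ν = x → ν ∈ O := by
    intro ν hν hνx
    have : ∃ V ∈ 𝓝 ν, Metric.ediam (q '' (D ∩ V)) ≤ ENNReal.ofReal (ε / 2) := by
      by_contra! h
      exact hcon ⟨ν, ⟨hν, h⟩, hνx⟩
    obtain ⟨V, hV, hVd⟩ := this
    obtain ⟨W, hWV, hW, hνW⟩ := mem_nhds_iff.1 hV
    exact ⟨W, ⟨hW, ⟨ν, ⟨hν, hνW⟩, hνx⟩, (Metric.ediam_mono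
      (image_mono (inter_subset_inter_right D hWV))).trans hVd⟩, hνW⟩
  have hcl : IsClosed ((fun ν => StrongDual.toWeakDual (q ν)) '' (D \ O)) :=
    ((hD.isCompact.diff hOo).image hq).isClosed
  have hxW : StrongDual.toWeakDual x ∈ ((fun ν => StrongDual.toWeakDual (q ν)) '' (D \ O))ᶜ := by
    rintro ⟨ν, hν, hνx⟩
    exact hν.2 (hfib ν hν.1 (StrongDual.toWeakDual.injective hνx))
  obtain ⟨y, ⟨ν, hν, rfl⟩, z, ⟨ν', hν', rfl⟩, hy, hz, hyz⟩ :=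
    exists_dist_of_mem_derivation hx (hcl.isOpen_compl.mem_nhds hxW)
  have key : ∀ ν ∈ D, StrongDual.toWeakDual (q ν) ∈
      ((fun ν => StrongDual.toWeakDual (q ν)) '' (D \ O))ᶜ →
      edist (q ν) x ≤ ENNReal.ofReal (ε / 2) := by
    intro ν hν hνW
    have hνO : ν ∈ O := by
      by_contra hνO
      exact hνW ⟨ν, ⟨hν, hνO⟩, rfl⟩
    obtain ⟨V, ⟨hVo, ⟨κ, hκ, rfl⟩, hVd⟩, hνV⟩ := hνO
    exact (Metric.edist_le_ediam_of_mem (s := q '' (D ∩ V)) (mem_image_of_mem q ⟨hν, hνV⟩)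
      (mem_image_of_mem q hκ)).trans hVd
  refine hyz.not_ge ((edist_triangle_right _ _ x).trans ?_)
  calc _ ≤ ENNReal.ofReal (ε / 2) + ENNReal.ofReal (ε / 2) :=
        add_le_add (key ν hν hy) (key ν' hν' hz)
    _ = ENNReal.ofReal ε := by
        rw [← ENNReal.ofReal_add (by positivity) (by positivity), add_halves]

/-- The transfinite form of `derivation_image_subset`; at limit ordinals compactness of the fibres
of `q` provides a common lift. -/
theorem iterDerivation_image_subset {P : Type*} [TopologicalSpace P] [CompactSpace P]
    {q : P → StrongDual 𝕜 X} (hq : Continuous fun ν => StrongDual.toWeakDual (q ν)) {ε : ℝ}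
    (hε : 0 < ε) (ξ : Ordinal.{v}) :
    iter (derivation ε) (range q) ξ ⊆ q '' iter (derivationAlong q (ε / 2)) univ ξ := by
  have hcl : ∀ ξ : Ordinal.{v}, IsClosed (iter (derivationAlong q (ε / 2)) univ ξ) :=
    iter_isClosed (derivationAlong_isClosed q _) isClosed_univ
  induction ξ using Ordinal.limitRecOn with
  | zero => simp
  | add_one ξ ih =>
    rw [iter_add_one, iter_add_one]
    exact (derivation_mono ε ih).trans (derivation_image_subset hq hε (hcl ξ))
  | limit ξ hξ ih =>
    rw [iter_limit _ _ hξ, iter_limit _ _ hξ]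
    intro x hx
    rw [mem_iInter₂] at hx
    have hfib : IsClosed (q ⁻¹' {x}) := by
      have : q ⁻¹' {x} = (fun ν => StrongDual.toWeakDual (q ν)) ⁻¹' {StrongDual.toWeakDual x} := by
        ext ν
        simp
      rw [this]
      exact isClosed_singleton.preimage hq
    have : Nonempty (Iio ξ) := ⟨⟨0, hξ.bot_lt⟩⟩
    obtain ⟨ν, hν⟩ := IsCompact.nonempty_iInter_of_directed_nonempty_isCompact_isClosed
      (fun ζ : Iio ξ => iter (derivationAlong q (ε / 2)) univ ζ.1 ∩ q ⁻¹' {x})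
      (directed_of_isDirected_le fun a b hab =>
        inter_subset_inter_left _ (iter_antitone (derivationAlong_subset q _) hab))
      (fun ζ => by
        obtain ⟨ν, hν, hνx⟩ := ih ζ.1 ζ.2 (hx ζ.1 ζ.2)
        exact ⟨ν, hν, hνx⟩)
      (fun ζ => ((hcl _).inter hfib).isCompact) (fun ζ => (hcl _).inter hfib)
    rw [mem_iInter] at hν
    exact ⟨ν, mem_iInter₂.2 fun ζ hζ => (hν ⟨ζ, hζ⟩).1, (hν ⟨0, hξ.bot_lt⟩).2⟩

end Dual

/-! ### Continuous families of contents -/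

section Content

variable {P Ω : Type*} [TopologicalSpace P] [TopologicalSpace Ω]

/-- A family of finitely additive nonnegative set functions on `Ω` that depends continuously on a
parameter in `P`, set by set. -/
structure IsContentFamily (m : P → Set Ω → ℝ) : Prop where
  nonneg : ∀ ν A, 0 ≤ m ν A
  union : ∀ ν A B, Disjoint A B → m ν (A ∪ B) = m ν A + m ν B
  continuous : ∀ A, Continuous fun ν => m ν A

/-- The outer value of a content at `C`: the infimum of its values at the open sets that
contain `C`. -/
noncomputable def outerContent (m : P → Set Ω → ℝ) (ν : P) (C : Set Ω) : ℝ :=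
  ⨅ O : {O : Set Ω // IsOpen O ∧ C ⊆ O}, m ν O

variable {m : P → Set Ω → ℝ}

namespace IsContentFamily

theorem mono (hm : IsContentFamily m) (ν : P) {A B : Set Ω} (h : A ⊆ B) : m ν A ≤ m ν B := by
  rw [← union_sdiff_cancel h, hm.union ν _ _ disjoint_sdiff_right]
  linarith [hm.nonneg ν (B \ A)]

theorem empty (hm : IsContentFamily m) (ν : P) : m ν ∅ = 0 := by
  have := hm.union ν ∅ ∅ (by simp)
  simpa using this

theorem union_le (hm : IsContentFamily m) (ν : P) (A B : Set Ω) : m ν (A ∪ B) ≤ m ν A + m ν B := by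
  rw [← union_sdiff_self, hm.union ν _ _ disjoint_sdiff_right]
  linarith [hm.mono ν (sdiff_subset : B \ A ⊆ B)]

theorem sum_le (hm : IsContentFamily m) (ν : P) {ι : Type*} (s : Finset ι) {Q : ι → Set Ω}
    (hQ : Pairwise fun i j => Disjoint (Q i) (Q j)) {O : Set Ω} (h : ∀ i, Q i ⊆ O) :
    ∑ i ∈ s, m ν (Q i) ≤ m ν O := by
  classical
  suffices ∑ i ∈ s, m ν (Q i) = m ν (⋃ i ∈ s, Q i) from
    this.trans_le (hm.mono ν (iUnion₂_subset fun i _ => h i))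
  induction s using Finset.induction_on with
  | empty => simp [hm.empty]
  | insert i s hi ih =>
    rw [Finset.sum_insert hi, ih, Finset.set_biUnion_insert, hm.union]
    exact disjoint_iUnion₂_right.2 fun j hj => hQ (by rintro rfl; exact hi hj)

theorem bddBelow (hm : IsContentFamily m) (ν : P) (C : Set Ω) :
    BddBelow (range fun O : {O : Set Ω // IsOpen O ∧ C ⊆ O} => m ν O) :=
  ⟨0, by rintro _ ⟨O, rfl⟩; exact hm.nonneg ν O⟩

theorem outer_le (hm : IsContentFamily m) (ν : P) {C O : Set Ω} (hO : IsOpen O) (h : C ⊆ O) :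
    outerContent m ν C ≤ m ν O :=
  ciInf_le (hm.bddBelow ν C) (⟨O, hO, h⟩ : {O : Set Ω // IsOpen O ∧ C ⊆ O})

theorem le_outer {ν : P} {C : Set Ω} {a : ℝ} (h : ∀ O, IsOpen O → C ⊆ O → a ≤ m ν O) :
    a ≤ outerContent m ν C := by
  have : Nonempty {O : Set Ω // IsOpen O ∧ C ⊆ O} := ⟨⟨univ, isOpen_univ, subset_univ C⟩⟩
  exact le_ciInf fun O => h O O.2.1 O.2.2

theorem exists_of_outer_lt {ν : P} {C : Set Ω} {a : ℝ} (h : outerContent m ν C < a) :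
    ∃ O, IsOpen O ∧ C ⊆ O ∧ m ν O < a := by
  by_contra! hcon
  exact h.not_ge (le_outer hcon)

theorem outer_nonneg (hm : IsContentFamily m) (ν : P) (C : Set Ω) : 0 ≤ outerContent m ν C :=
  le_outer fun O _ _ => hm.nonneg ν O

theorem outer_mono (hm : IsContentFamily m) (ν : P) {C C' : Set Ω} (h : C ⊆ C') :
    outerContent m ν C ≤ outerContent m ν C' :=
  le_outer fun _ hO hC => hm.outer_le ν hO (h.trans hC)

/-- Outer values are upper semicontinuous in the parameter. -/
theorem isOpen_outer_lt (hm : IsContentFamily m) (C : Set Ω) (a : ℝ) :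
    IsOpen {ν | outerContent m ν C < a} := by
  rw [isOpen_iff_mem_nhds]
  intro ν hν
  obtain ⟨O, hO, hC, h⟩ := exists_of_outer_lt hν
  filter_upwards [(hm.continuous O).continuousAt.eventually_lt continuousAt_const h] with ν' h'
  exact (hm.outer_le ν' hO hC).trans_lt h'

end IsContentFamily

end Content

/-! ### Counting derivations by the mass on the levels -/

section Pinned

universe w

variable {P Ω : Type*} [TopologicalSpace P] [TopologicalSpace Ω]

/-- Every member of `D` has more than the threshold `t` of its mass pinned to the finitely many
pairwise separated blocks of levels `[ζ i, ζ i + θ)`: the block `i` carries at least `a i - b i`,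
and these numbers add up to more than `t`. -/
def IsPinned {ι : Type} [Fintype ι] (m : P → Set Ω → ℝ) (Lev : Ordinal.{w} → Set Ω) (D : Set P)
    (ζ : ι → Ordinal.{w}) (a b : ι → ℝ) (θ : Ordinal.{w}) (t : ℝ) : Prop :=
  (Pairwise fun i j => ζ i + θ ≤ ζ j ∨ ζ j + θ ≤ ζ i) ∧
  (∀ ν ∈ D, ∀ i, a i ≤ outerContent m ν (Lev (ζ i)) ∧
    outerContent m ν (Lev (ζ i + θ)) ≤ b i) ∧
  t < ∑ i, (a i - b i)

/-- A decreasing family of compact levels, continuous at limit ordinals, such that the points lost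
between consecutive levels have neighbourhoods that meet the larger level in a small set. -/
structure IsLevelFamily (small : Set Ω → Prop) (Lev : Ordinal.{w} → Set Ω) : Prop where
  antitone : Antitone Lev
  isCompact : ∀ ξ, IsCompact (Lev ξ)
  limit : ∀ ξ, Order.IsSuccLimit ξ → ∀ O, IsOpen O → Lev ξ ⊆ O → ∃ ζ < ξ, Lev ζ ⊆ O
  locally_small : ∀ ξ, ∀ x ∈ Lev ξ, x ∉ Lev (ξ + 1) → ∃ V ∈ 𝓝 x, small (V ∩ Lev ξ)
  small_mono : ∀ A B, A ⊆ B → small B → small A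

/-- A derivation on subsets of a topological space: decreasing, monotone, and such that whether a
point survives is decided in its neighbourhoods. -/
structure IsLocalDerivation (d : Set P → Set P) : Prop where
  subset : ∀ S, d S ⊆ S
  mono : Monotone d
  inter : ∀ S U, IsOpen U → d S ∩ U ⊆ d (S ∩ U)

variable {m : P → Set Ω → ℝ} {small : Set Ω → Prop} {Lev : Ordinal.{w} → Set Ω}
  {d : Set P → Set P} {S : Set P} {t : ℝ}

theorem IsLocalDerivation.notMem_iter (hd : IsLocalDerivation d) {D U : Set P} (hU : IsOpen U)
    {ξ ξ' : Ordinal.{w}} (h : iter d (D ∩ U) ξ' = ∅) (hξ : ξ' ≤ ξ) {ν : P} (hν : ν ∈ U) :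
    ν ∉ iter d D ξ := fun hν' => by
  have := iter_antitone hd.subset hξ (iter_inter_isOpen hd.mono hd.inter hU ξ ⟨hν', hν⟩)
  simp [h] at this

/-- The condition under which finitely many derivations exhaust a set of parameters: its contents
charge every neighbourhood of a compact, locally small subset `R` of the largest level with more
than `t`. -/
def ExhaustsConcentrated (m : P → Set Ω → ℝ) (small : Set Ω → Prop) (Lev : Ordinal.{w} → Set Ω)
    (d : Set P → Set P) (S : Set P) (t : ℝ) : Prop :=
  ∀ D R, D ⊆ S → IsCompact R → R ⊆ Lev 0 → (∀ r ∈ R, ∃ V ∈ 𝓝 r, small (V ∩ R)) →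
    (∀ ν ∈ D, ∀ O, IsOpen O → R ⊆ O → t < m ν O) → ∃ M : ℕ, iter d D (M : Ordinal.{w}) = ∅

/-- Mass pinned to single levels: near each `ν ∈ D` more than `t` of the mass lies close to the
compact, locally small set `⋃ i, Lev (ζ i) \ O i`, where `O i` is a neighbourhood of
`Lev (ζ i + 1)` of content little more than `b i`. -/
theorem iter_omega0_of_isPinned_one (hm : IsContentFamily m) (hLev : IsLevelFamily small Lev)
    (hd : IsLocalDerivation d) (hbase : ExhaustsConcentrated m small Lev d S t)
    {ι : Type} [Fintype ι] {D : Set P} {ζ : ι → Ordinal.{w}} {a b : ι → ℝ} (hD : D ⊆ S)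
    (hpin : IsPinned m Lev D ζ a b 1 t) : iter d D (ω : Ordinal.{w}) = ∅ := by
  obtain ⟨hsep, hab, ht⟩ := hpin
  rw [eq_empty_iff_forall_notMem]
  intro ν hν
  set e : ℝ := (∑ i, (a i - b i) - t) / (Fintype.card ι + 1) with he
  have he0 : 0 < e := by
    apply div_pos (by linarith)
    positivity
  have hec : t < ∑ i, (a i - b i) - Fintype.card ι * e := by
    have : e * (Fintype.card ι + 1) = ∑ i, (a i - b i) - t := by
      rw [he]; field_simp
    linarith
  have hνD := iter_subset hd.subset _ hν
  choose O hOo hLO hOb using fun i => IsContentFamily.exists_of_outer_lt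
    (((hab ν hνD i).2).trans_lt (lt_add_of_pos_right (b i) he0))
  set U : Set P := ⋂ i, {ν' | m ν' (O i) < b i + e} with hU
  have hUo : IsOpen U := isOpen_iInter_of_finite fun i =>
    isOpen_lt (hm.continuous (O i)) continuous_const
  have hνU : ν ∈ U := mem_iInter.2 hOb
  have hne : ∀ i j, i ≠ j → ζ i ≠ ζ j := by
    intro i j hij h
    rcases hsep hij with h' | h' <;> simp [h] at h'
  have hle : ∀ i j, ζ i < ζ j → Lev (ζ j) ⊆ O i := fun i j hij =>
    (hLev.antitone (Order.add_one_le_of_lt hij)).trans (hLO i)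
  set R : Set Ω := ⋃ i, Lev (ζ i) \ O i with hR
  suffices h : ∃ M : ℕ, iter d (D ∩ U) (M : Ordinal.{w}) = ∅ by
    obtain ⟨M, hM⟩ := h
    exact hd.notMem_iter hUo hM (Ordinal.natCast_lt_omega0 M).le hνU hν
  refine hbase (D ∩ U) R (inter_subset_left.trans hD)
    (isCompact_iUnion fun i => (hLev.isCompact _).diff (hOo i))
    (iUnion_subset fun i => sdiff_subset.trans (hLev.antitone zero_le)) ?_ ?_
  · rintro r hr
    obtain ⟨i, hri, hrO⟩ := mem_iUnion.1 hr
    obtain ⟨V, hV, hVs⟩ := hLev.locally_small _ r hri (fun h => hrO (hLO i h))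
    refine ⟨V ∩ ⋂ (j) (_ : ζ j < ζ i), O j, Filter.inter_mem hV ?_,
      hLev.small_mono _ _ ?_ hVs⟩
    · refine (isOpen_iInter_of_finite fun j => isOpen_iInter_of_finite fun _ => hOo j).mem_nhds ?_
      exact mem_iInter₂.2 fun j hj => hle j i hj hri
    · rintro s ⟨⟨hsV, hsO⟩, hsR⟩
      refine ⟨hsV, ?_⟩
      obtain ⟨j, hsj, hsOj⟩ := mem_iUnion.1 hsR
      refine hLev.antitone (not_lt.1 fun hlt => hsOj ?_) hsj
      exact mem_iInter₂.1 hsO j hlt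
  · rintro ν' ⟨hν'D, hν'U⟩ G hG hRG
    -- The sets `Q i` are disjoint, and `Q i ∪ O i` is an open set that contains `Lev (ζ i)`.
    set G' : ι → Set Ω := fun i => G ∩ ⋂ (j) (_ : ζ j < ζ i), O j with hG'
    set Q : ι → Set Ω := fun i => G' i \ O i with hQ
    have hQd : Pairwise fun i j => Disjoint (Q i) (Q j) := by
      have key : ∀ i j, ζ i < ζ j → Disjoint (Q i) (Q j) := fun i j hij =>
        disjoint_left.2 fun x hxi hxj => hxi.2 (mem_iInter₂.1 hxj.1.2 i hij)
      intro i j hij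
      rcases lt_or_gt_of_ne (hne i j hij) with h | h
      · exact key i j h
      · exact (key j i h).symm
    have hQm : ∀ i, a i - b i - e ≤ m ν' (Q i) := by
      intro i
      have h1 : a i ≤ m ν' (G' i ∪ O i) := by
        refine (hab ν' hν'D i).1.trans (hm.outer_le ν' ?_ ?_)
        · refine (hG.inter ?_).union (hOo i)
          exact isOpen_iInter_of_finite fun j => isOpen_iInter_of_finite fun _ => hOo j
        · intro x hx
          by_cases hxO : x ∈ O i
          · exact Or.inr hxO
          · exact Or.inl ⟨hRG (mem_iUnion.2 ⟨i, hx, hxO⟩),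
              mem_iInter₂.2 fun j hj => hle j i hj hx⟩
      have h2 : m ν' (G' i ∪ O i) ≤ m ν' (Q i) + m ν' (O i) := by
        rw [show G' i ∪ O i = Q i ∪ O i by simp [hQ]]
        exact hm.union_le ν' _ _
      have h3 : m ν' (O i) < b i + e := mem_iInter.1 hν'U i
      linarith
    calc t < ∑ i, (a i - b i) - Fintype.card ι * e := hec
      _ = ∑ i, (a i - b i - e) := by
        rw [Finset.sum_sub_distrib (g := fun _ => e)]
        simp
      _ ≤ ∑ i, m ν' (Q i) := Finset.sum_le_sum fun i _ => hQm i
      _ ≤ m ν' G := hm.sum_le ν' _ hQd fun i => sdiff_subset.trans inter_subset_left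

/-- Blocks of length `ω ^ γ * n`: the sum of the outer contents of the `ω ^ γ`-blocks bounds the
number of rounds of `ω * ω ^ γ` derivations, because within a round during which it moves by less
than a fixed amount, the mass stays pinned to the blocks of length `ω ^ γ`. The number `l` of rounds
does not depend on `m`, `S` and `t`. -/
theorem exists_iter_of_isPinned_mul (hd : IsLocalDerivation d) (C : ℝ) (γ : Ordinal.{w})
    (ι : Type) [Fintype ι] {n : ℕ} (hn : 0 < n) {e : ℝ} (he : 0 < e) :
    ∃ l : ℕ, ∀ (m : P → Set Ω → ℝ) (S : Set P) (t : ℝ), IsContentFamily m →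
      (∀ ν ∈ S, m ν univ ≤ C) →
      (∀ (κ : Type) [Fintype κ] (D : Set P) (ζ : κ → Ordinal.{w}) (a b : κ → ℝ), D ⊆ S →
        IsPinned m Lev D ζ a b (ω ^ γ) t → iter d D (ω * ω ^ γ) = ∅) →
      ∀ (D : Set P) (ζ : ι → Ordinal.{w}) (a b : ι → ℝ), D ⊆ S →
        IsPinned m Lev D ζ a b (ω ^ γ * n) (t + e) → iter d D (ω * ω ^ γ * l) = ∅ := by
  set N : ℝ := (Fintype.card (ι × Fin n) : ℝ) with hN
  have hN0 : 0 ≤ N := Nat.cast_nonneg _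
  set e' : ℝ := e / (N * (N + 2) + 1) with he'
  have he'0 : 0 < e' := by positivity
  have hee' : N * (N + 2) * e' < e := by
    have : e' * (N * (N + 2) + 1) = e := by rw [he']; field_simp
    linarith
  obtain ⟨l, hl⟩ := exists_nat_gt (N * C / e')
  refine ⟨l, fun m S t hm hC hγ D ζ a b hD ⟨hsep, hab, ht⟩ => ?_⟩
  set η : ι × Fin n → Ordinal.{w} := fun x => ζ x.1 + ω ^ γ * (x.2 : ℕ) with hη
  set B : P → ℝ := fun ν => ∑ x, outerContent m ν (Lev (η x)) with hB
  have hBC : ∀ ν ∈ D, B ν ≤ N * C := by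
    intro ν hν
    calc B ν ≤ ∑ _x : ι × Fin n, C := Finset.sum_le_sum fun x _ =>
          (hm.outer_le ν isOpen_univ (subset_univ _)).trans (hC ν (hD hν))
      _ = N * C := by rw [Finset.sum_const, nsmul_eq_mul, Finset.card_univ]
  have hηsep : Pairwise fun x y => η x + ω ^ γ ≤ η y ∨ η y + ω ^ γ ≤ η x := by
    have hη1 : ∀ x, η x + ω ^ γ = ζ x.1 + ω ^ γ * ((x.2 : ℕ) + 1 : ℕ) := by
      intro x
      rw [Nat.cast_add_one, mul_add_one, hη, add_assoc]
    have hηlt : ∀ x y : ι × Fin n, x.1 = y.1 → x.2 < y.2 → η x + ω ^ γ ≤ η y := by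
      intro x y h1 h2
      rw [hη1, h1]
      simp only [hη]
      gcongr
      exact h2
    have hηn : ∀ x y : ι × Fin n, ζ x.1 + ω ^ γ * n ≤ ζ y.1 → η x + ω ^ γ ≤ η y := by
      intro x y h
      rw [hη1]
      refine (le_trans ?_ h).trans le_self_add
      gcongr
      exact x.2.2
    intro x y hxy
    by_cases h1 : x.1 = y.1
    · have h2 : x.2 ≠ y.2 := fun h2 => hxy (Prod.ext h1 h2)
      rcases lt_or_gt_of_ne h2 with h | h
      · exact Or.inl (hηlt x y h1 h)
      · exact Or.inr (hηlt y x h1.symm h)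
    · exact (hsep h1).imp (hηn x y) (hηn y x)
  have hround : ∀ k : ℕ, iter d (D ∩ {ν | k * e' ≤ B ν}) (ω * ω ^ γ) ⊆
      D ∩ {ν | (k + 1 : ℕ) * e' ≤ B ν} := by
    intro k ν hν
    have hνS := iter_subset hd.subset _ hν
    refine ⟨hνS.1, ?_⟩
    by_contra hlt
    rw [mem_ofPred_eq, not_le] at hlt
    push_cast at hlt
    set U : Set P := ⋂ x, {ν' | outerContent m ν' (Lev (η x)) <
      outerContent m ν (Lev (η x)) + e'} with hU
    have hUo : IsOpen U := isOpen_iInter_of_finite fun x => hm.isOpen_outer_lt _ _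
    have hνU : ν ∈ U := mem_iInter.2 fun x => by simpa using he'0
    set c : ι → ℕ → ℝ := fun i j =>
      if j < n then outerContent m ν (Lev (ζ i + ω ^ γ * j)) else b i with hc
    refine hd.notMem_iter hUo (hγ (ι × Fin n) _ η
      (fun x => c x.1 x.2 - (N + 1) * e') (fun x => c x.1 (x.2 + 1) + e')
      (inter_subset_left.trans (inter_subset_left.trans hD)) ⟨hηsep, ?_, ?_⟩) le_rfl hνU hν
    · rintro ν' ⟨⟨hν'D, hν'B⟩, hν'U⟩ x
      have hU' : ∀ y, outerContent m ν' (Lev (η y)) < outerContent m ν (Lev (η y)) + e' :=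
        fun y => mem_iInter.1 hν'U y
      constructor
      · have hcx : c x.1 x.2 = outerContent m ν (Lev (η x)) := by simp [hc, hη]
        simp only [hcx]
        -- All terms of `B ν'` exceed those of `B ν` by less than `e'`, so none can be much smaller.
        have h1 : ∑ y, (outerContent m ν (Lev (η y)) + e' - outerContent m ν' (Lev (η y))) =
            B ν + N * e' - B ν' := by
          rw [Finset.sum_sub_distrib, Finset.sum_add_distrib, Finset.sum_const, nsmul_eq_mul,
            Finset.card_univ]
        have h2 := Finset.single_le_sum (s := Finset.univ)
          (f := fun y => outerContent m ν (Lev (η y)) + e' - outerContent m ν' (Lev (η y)))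
          (fun y _ => by linarith [hU' y]) (Finset.mem_univ x)
        rw [h1] at h2
        have h3 : k * e' ≤ B ν' := hν'B
        linarith
      · have hηx : η x + ω ^ γ = ζ x.1 + ω ^ γ * ((x.2 : ℕ) + 1 : ℕ) := by
          rw [Nat.cast_add_one, mul_add_one, hη, add_assoc]
        rw [hηx]
        by_cases hx : (x.2 : ℕ) + 1 < n
        · have := hU' (x.1, ⟨x.2 + 1, hx⟩)
          simp only [hc, hη, if_pos hx] at this ⊢
          exact this.le
        · have hx' : (x.2 : ℕ) + 1 = n := by have := x.2.2; omega
          simp only [hc, if_neg hx]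
          rw [hx']
          linarith [(hab ν' hν'D x.1).2]
    · have hsum : ∑ x : ι × Fin n, (c x.1 x.2 - (N + 1) * e' - (c x.1 (x.2 + 1) + e')) =
          ∑ i, (c i 0 - c i n) - N * (N + 2) * e' := by
        have h1 : ∀ x : ι × Fin n, c x.1 x.2 - (N + 1) * e' - (c x.1 (x.2 + 1) + e') =
            (c x.1 x.2 - c x.1 (x.2 + 1)) - (N + 2) * e' := fun x => by ring
        simp_rw [h1]
        rw [Finset.sum_sub_distrib (g := fun _ => (N + 2) * e'), Finset.sum_const, nsmul_eq_mul,
          Finset.card_univ, Fintype.sum_prod_type, ← hN, mul_assoc]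
        congr 1
        refine Finset.sum_congr rfl fun i _ => ?_
        rw [Fin.sum_univ_eq_sum_range (fun j => c i j - c i (j + 1)), Finset.sum_range_sub']
      have hai : ∑ i, (a i - b i) ≤ ∑ i, (c i 0 - c i n) := by
        refine Finset.sum_le_sum fun i _ => ?_
        have := (hab ν hνS.1 i).1
        simpa [hc, hn] using this
      rw [hsum]
      linarith
  have := iter_mul_nat hd.subset hd.mono (S := fun k => D ∩ {ν | k * e' ≤ B ν}) hround l
  refine eq_empty_of_subset_empty fun ν hν => ?_
  have hD0 : D ⊆ D ∩ {ν | ((0 : ℕ) : ℝ) * e' ≤ B ν} := fun ν hν => ⟨hν, by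
    simpa using Finset.sum_nonneg fun x _ => hm.outer_nonneg ν _⟩
  obtain ⟨h1, h2⟩ := this (iter_mono hd.mono hD0 _ hν)
  rw [div_lt_iff₀ he'0] at hl
  exact absurd (hBC ν h1) (by simp only [mem_ofPred_eq] at h2; linarith)

/-- Mass pinned to blocks of `ω ^ γ` levels is exhausted by `ω * ω ^ γ` derivations. -/
theorem iter_of_isPinned_opow (hm : IsContentFamily m) (hLev : IsLevelFamily small Lev)
    (hd : IsLocalDerivation d) {C : ℝ} (hC : ∀ ν ∈ S, m ν univ ≤ C)
    (hbase : ExhaustsConcentrated m small Lev d S t) (γ : Ordinal.{w}) :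
    ∀ (ι : Type) [Fintype ι] (D : Set P) (ζ : ι → Ordinal.{w}) (a b : ι → ℝ), D ⊆ S →
      IsPinned m Lev D ζ a b (ω ^ γ) t → iter d D (ω * ω ^ γ) = ∅ := by
  induction γ using WellFoundedLT.induction with
  | ind γ ih =>
  intro ι _ D ζ a b hD hpin
  rcases eq_or_ne γ 0 with rfl | hγ
  · rw [Ordinal.opow_zero] at hpin ⊢
    rw [mul_one]
    exact iter_omega0_of_isPinned_one hm hLev hd hbase hD hpin
  obtain ⟨hsep, hab, ht⟩ := hpin
  rw [eq_empty_iff_forall_notMem]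
  intro ν hν
  have hνD := iter_subset hd.subset _ hν
  set e : ℝ := (∑ i, (a i - b i) - t) / 2 with he
  have he0 : 0 < e := by
    apply div_pos (by linarith)
    positivity
  set e' : ℝ := e / (Fintype.card ι + 1) with he'
  have he'0 : 0 < e' := by positivity
  have hee' : Fintype.card ι * e' < e := by
    have : e' * (Fintype.card ι + 1) = e := by rw [he']; field_simp
    linarith
  -- By compactness the blocks may be shortened, near `ν`, to a length `ω ^ γ' * n` with `γ' < γ`.
  have hβ : ∀ i, ∃ β < ω ^ γ, outerContent m ν (Lev (ζ i + β)) < b i + e' := by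
    intro i
    obtain ⟨O, hO, hLO, hOb⟩ := IsContentFamily.exists_of_outer_lt
      (((hab ν hνD i).2).trans_lt (lt_add_of_pos_right (b i) he'0))
    obtain ⟨ξ, hξ, hξO⟩ := hLev.limit _ (Ordinal.isSuccLimit_add _
      (Ordinal.isSuccLimit_opow_left Ordinal.isSuccLimit_omega0 hγ)) O hO hLO
    obtain ⟨β, hβ, hξβ⟩ := (Ordinal.lt_add_iff (Ordinal.opow_ne_zero _
      Ordinal.omega0_ne_zero)).1 hξ
    exact ⟨β, hβ, (hm.outer_le ν hO ((hLev.antitone hξβ).trans hξO)).trans_lt hOb⟩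
  choose β hβ hβb using hβ
  have hsup : Finset.univ.sup β < ω ^ γ :=
    (Finset.sup_lt_iff (Ordinal.opow_pos _ Ordinal.omega0_pos)).2 fun i _ => hβ i
  obtain ⟨γ', hγ', n, hn⟩ := (Ordinal.lt_omega0_opow hγ).1 hsup
  have hn0 : 0 < n := by
    rcases Nat.eq_zero_or_pos n with rfl | h
    · simp at hn
    · exact h
  have hmul : ∀ k : ℕ, ω ^ γ' * k ≤ ω ^ γ := fun k =>
    (Ordinal.opow_mul_lt_opow (Ordinal.natCast_lt_omega0 k) hγ').le
  obtain ⟨l, hl⟩ := exists_iter_of_isPinned_mul (Ω := Ω) (Lev := Lev) hd C γ' ι hn0 he0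
  set U : Set P := ⋂ i, {ν' | outerContent m ν' (Lev (ζ i + ω ^ γ' * n)) < b i + e'} with hU
  have hUo : IsOpen U := isOpen_iInter_of_finite fun i => hm.isOpen_outer_lt _ _
  have hνU : ν ∈ U := mem_iInter.2 fun i => by
    refine (hm.outer_mono ν (hLev.antitone ?_)).trans_lt (hβb i)
    gcongr
    exact (Finset.le_sup (Finset.mem_univ i)).trans hn.le
  refine hd.notMem_iter hUo (hl m S t hm hC (ih γ' hγ') (D ∩ U) ζ a (fun i => b i + e')
    (inter_subset_left.trans hD) ⟨?_, ?_, ?_⟩) ?_ hνU hν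
  · intro i j hij
    refine (hsep hij).imp (fun h => le_trans ?_ h) (fun h => le_trans ?_ h) <;>
    · gcongr
      exact hmul n
  · rintro ν' ⟨hν'D, hν'U⟩ i
    exact ⟨(hab ν' hν'D i).1, (mem_iInter.1 hν'U i).le⟩
  · have : ∑ i, (a i - (b i + e')) = ∑ i, (a i - b i) - Fintype.card ι * e' := by
      simp_rw [← sub_sub]
      rw [Finset.sum_sub_distrib (g := fun _ => e')]
      simp
    rw [this]
    linarith
  · rw [mul_assoc]
    gcongr
    exact hmul l

end Pinned

/-! ### Uniform smoothness of `L_p` -/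

section Smooth

/-- Uniform smoothness of a normed space. -/
def IsUniformlySmooth (W : Type*) [NormedAddCommGroup W] [NormedSpace ℝ W] : Prop :=
  ∀ η : ℝ, 0 < η → ∃ s : ℝ, 0 < s ∧ ∀ u v : W, ‖u‖ ≤ 1 → ‖v‖ ≤ 1 →
    ‖u + s • v‖ + ‖u - s • v‖ ≤ 2 + η * s

/-- The scalar inequality behind the uniform smoothness of `L_p`. -/
theorem exists_abs_add_rpow_le {r : ℝ} (hr : 1 < r) {η : ℝ} (hη : 0 < η) :
    ∃ s : ℝ, 0 < s ∧ ∀ a b : ℝ, |a + s * b| ^ r + |a - s * b| ^ r ≤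
      2 * |a| ^ r + η * s * (|a| ^ r + |b| ^ r) := by
  set ψ : ℝ → ℝ := fun x => r * |x| ^ (r - 2) * x with hψ
  have hder : ∀ x, HasDerivAt (fun y : ℝ => |y| ^ r) (ψ x) x := fun x => hasDerivAt_abs_rpow x hr
  have hψc : Continuous ψ := by
    have h1 : ∀ x, ψ x = r * (SignType.sign x * |x| ^ (r - 1)) := by
      intro x
      rcases eq_or_ne x 0 with rfl | hx
      · simp [hψ]
      · have : |x| ^ (r - 1) = |x| ^ (r - 2) * |x| := by
          rw [← Real.rpow_add_one (abs_pos.2 hx).ne']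
          ring_nf
        rw [this, hψ]
        have h2 := sign_mul_abs x
        linear_combination (-r * |x| ^ (r - 2)) * h2
    have h2 : ψ = deriv (fun y : ℝ => |y| ^ r) := funext fun x => (hder x).deriv.symm
    rw [continuous_iff_continuousAt]
    intro x
    rcases eq_or_ne x 0 with rfl | hx
    · have h0 : ψ 0 = 0 := by simp [hψ]
      rw [ContinuousAt, h0]
      refine squeeze_zero_norm (a := fun x : ℝ => r * |x| ^ (r - 1)) (fun x => ?_) ?_
      · rw [h1, norm_mul, norm_mul, Real.norm_of_nonneg (by linarith : (0 : ℝ) ≤ r),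
          Real.norm_of_nonneg (by positivity : (0 : ℝ) ≤ |x| ^ (r - 1))]
        gcongr
        refine mul_le_of_le_one_left (by positivity) ?_
        rcases lt_trichotomy x 0 with h | h | h <;> simp [h]
      · have : Filter.Tendsto (fun x : ℝ => r * |x| ^ (r - 1)) (𝓝 0) (𝓝 (r * |0| ^ (r - 1))) := by
          apply Continuous.tendsto
          exact continuous_const.mul (continuous_abs.rpow_const fun x => Or.inr (by linarith))
        simpa [Real.zero_rpow (by linarith : r - 1 ≠ 0)] using this
    · have : ContinuousAt (fun x : ℝ => r * |x| ^ (r - 2) * x) x := by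
        refine (continuousAt_const.mul ?_).mul continuousAt_id
        exact continuous_abs.continuousAt.rpow_const (Or.inl (by simpa using hx))
      exact this
  have huc : UniformContinuousOn ψ (Icc (-2) 2) :=
    isCompact_Icc.uniformContinuousOn_of_continuous hψc.continuousOn
  obtain ⟨δ, hδ, hδψ⟩ := Metric.uniformContinuousOn_iff_le.1 huc η hη
  set s := min 1 (δ / 2) with hs
  have hs0 : 0 < s := by positivity
  have hs1 : s ≤ 1 := min_le_left _ _
  have hsδ : 2 * s ≤ δ := by linarith [min_le_right 1 (δ / 2)]
  refine ⟨s, hs0, ?_⟩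
  -- On the unit square the mean value inequality applies; the general case follows by scaling.
  have unit : ∀ a b : ℝ, |a| ≤ 1 → |b| ≤ 1 →
      |a + s * b| ^ r + |a - s * b| ^ r ≤ 2 * |a| ^ r + η * s := by
    intro a b ha hb
    have hg : ∀ σ ∈ Icc (0 : ℝ) s, HasDerivWithinAt
        (fun σ : ℝ => |a + σ * b| ^ r + |a - σ * b| ^ r)
        (ψ (a + σ * b) * b + ψ (a - σ * b) * (-b)) (Icc 0 s) σ := by
      intro σ _
      refine HasDerivAt.hasDerivWithinAt ?_
      refine HasDerivAt.add ?_ ?_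
      · have h1 : HasDerivAt (fun σ : ℝ => a + σ * b) b σ := by
          simpa using ((hasDerivAt_id σ).mul_const b).const_add a
        exact (hder _).comp σ h1
      · have h1 : HasDerivAt (fun σ : ℝ => a - σ * b) (-b) σ := by
          simpa using ((hasDerivAt_id σ).mul_const b).const_sub a
        exact (hder _).comp σ h1
    have hbd : ∀ σ ∈ Icc (0 : ℝ) s,
        ‖ψ (a + σ * b) * b + ψ (a - σ * b) * (-b)‖ ≤ η := by
      intro σ hσ
      have hσb : |σ * b| ≤ s := by
        rw [abs_mul, abs_of_nonneg hσ.1]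
        nlinarith [hσ.2, abs_nonneg b, hσ.1]
      have hσ1 := abs_le.1 (hσb.trans hs1)
      have ha' := abs_le.1 ha
      have := hδψ (a + σ * b) ⟨by linarith, by linarith⟩ (a - σ * b)
        ⟨by linarith, by linarith⟩ (by
          rw [Real.dist_eq, show a + σ * b - (a - σ * b) = 2 * (σ * b) by ring, abs_mul]
          rw [abs_of_pos (two_pos : (0 : ℝ) < 2)]
          linarith)
      rw [Real.dist_eq] at this
      rw [show ψ (a + σ * b) * b + ψ (a - σ * b) * (-b) =
        (ψ (a + σ * b) - ψ (a - σ * b)) * b by ring, Real.norm_eq_abs, abs_mul]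
      nlinarith [abs_nonneg b, abs_nonneg (ψ (a + σ * b) - ψ (a - σ * b))]
    have := (convex_Icc (0 : ℝ) s).norm_image_sub_le_of_norm_hasDerivWithin_le hg hbd
      (left_mem_Icc.2 hs0.le) (right_mem_Icc.2 hs0.le)
    simp only [zero_mul, add_zero, sub_zero, Real.norm_eq_abs, abs_of_pos hs0] at this
    linarith [le_abs_self (|a + s * b| ^ r + |a - s * b| ^ r - (|a| ^ r + |a| ^ r))]
  intro a b
  set M := max |a| |b| with hM
  rcases eq_or_lt_of_le (le_max_of_le_left (abs_nonneg a) : 0 ≤ M) with h0 | h0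
  · have ha : a = 0 := abs_eq_zero.1 (le_antisymm (h0 ▸ le_max_left _ _) (abs_nonneg a))
    have hb : b = 0 := abs_eq_zero.1 (le_antisymm (h0 ▸ le_max_right _ _) (abs_nonneg b))
    simp [ha, hb, Real.zero_rpow (by linarith : r ≠ 0)]
  · have h1 := unit (a / M) (b / M)
      (by rw [abs_div, abs_of_pos h0]; exact div_le_one_of_le₀ (le_max_left _ _) h0.le)
      (by rw [abs_div, abs_of_pos h0]; exact div_le_one_of_le₀ (le_max_right _ _) h0.le)
    have hdiv : ∀ x, |x / M| ^ r = |x| ^ r / M ^ r := fun x => by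
      rw [abs_div, abs_of_pos h0, Real.div_rpow (abs_nonneg x) h0.le]
    rw [show a / M + s * (b / M) = (a + s * b) / M by ring,
      show a / M - s * (b / M) = (a - s * b) / M by ring, hdiv, hdiv, hdiv] at h1
    have hMr : 0 < M ^ r := Real.rpow_pos_of_pos h0 r
    have h2 : |a + s * b| ^ r + |a - s * b| ^ r ≤ 2 * |a| ^ r + η * s * M ^ r := by
      rw [← add_div, div_le_iff₀ hMr] at h1
      refine h1.trans_eq ?_
      field_simp
    have h3 : M ^ r ≤ |a| ^ r + |b| ^ r := by
      rcases le_total |a| |b| with h | h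
      · rw [hM, max_eq_right h]
        linarith [Real.rpow_nonneg (abs_nonneg a) r]
      · rw [hM, max_eq_left h]
        linarith [Real.rpow_nonneg (abs_nonneg b) r]
    have : η * s * M ^ r ≤ η * s * (|a| ^ r + |b| ^ r) := by gcongr
    linarith

variable {T : Type*} [MeasurableSpace T] {μ : Measure T} {p : ℝ≥0∞} [Fact (1 ≤ p)]

theorem toReal_pos_of_lt (hp' : p < ∞) : 0 < p.toReal :=
  ENNReal.toReal_pos (zero_lt_one.trans_le (Fact.out : 1 ≤ p)).ne' hp'.ne

theorem Lp_norm_rpow (hp' : p < ∞) {E : Type*} [NormedAddCommGroup E] (u : Lp E p μ) :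
    ‖u‖ ^ p.toReal = ∫ t, ‖u t‖ ^ p.toReal ∂μ := by
  have h0 := toReal_pos_of_lt hp'
  rw [Lp.norm_def, (Lp.memLp u).eLpNorm_eq_integral_rpow_norm
    (zero_lt_one.trans_le (Fact.out : 1 ≤ p)).ne' hp'.ne]
  have : 0 ≤ ∫ t, ‖u t‖ ^ p.toReal ∂μ := integral_nonneg fun t => by positivity
  rw [ENNReal.toReal_ofReal (by positivity), Real.rpow_inv_rpow this h0.ne']

theorem Lp_integrable_rpow (hp' : p < ∞) {E : Type*} [NormedAddCommGroup E] (u : Lp E p μ) :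
    Integrable (fun t => ‖u t‖ ^ p.toReal) μ :=
  (Lp.memLp u).integrable_norm_rpow (zero_lt_one.trans_le (Fact.out : 1 ≤ p)).ne' hp'.ne

theorem Lp_norm_sup_rpow_le (hp' : p < ∞) (u v : Lp ℝ p μ) :
    ‖u ⊔ v‖ ^ p.toReal ≤ ‖u‖ ^ p.toReal + ‖v‖ ^ p.toReal := by
  rw [Lp_norm_rpow hp', Lp_norm_rpow hp', Lp_norm_rpow hp',
    ← integral_add (Lp_integrable_rpow hp' u) (Lp_integrable_rpow hp' v)]
  refine integral_mono_ae (Lp_integrable_rpow hp' _)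
    ((Lp_integrable_rpow hp' u).add (Lp_integrable_rpow hp' v)) ?_
  filter_upwards [Lp.coeFn_sup u v] with t ht
  rw [ht, Pi.sup_apply]
  rcases le_total (u t) (v t) with h | h
  · rw [sup_eq_right.2 h]
    linarith [Real.rpow_nonneg (norm_nonneg (u t)) p.toReal]
  · rw [sup_eq_left.2 h]
    linarith [Real.rpow_nonneg (norm_nonneg (v t)) p.toReal]

omit [Fact (1 ≤ p)] in
theorem one_lt_toReal (hp : 1 < p) (hp' : p < ∞) : 1 < p.toReal := by
  rw [← ENNReal.toReal_one]
  exact (ENNReal.toReal_lt_toReal ENNReal.one_ne_top hp'.ne).2 hp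

theorem Lp_exists_norm_add_rpow_le (hp : 1 < p) (hp' : p < ∞) {η : ℝ} (hη : 0 < η) :
    ∃ s : ℝ, 0 < s ∧ ∀ u v : Lp ℝ p μ, ‖u + s • v‖ ^ p.toReal + ‖u - s • v‖ ^ p.toReal ≤
      2 * ‖u‖ ^ p.toReal + η * s * (‖u‖ ^ p.toReal + ‖v‖ ^ p.toReal) := by
  obtain ⟨s, hs, h⟩ := exists_abs_add_rpow_le (one_lt_toReal hp hp') hη
  refine ⟨s, hs, fun u v => ?_⟩
  have hi := fun w : Lp ℝ p μ => Lp_integrable_rpow hp' w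
  simp_rw [Lp_norm_rpow hp']
  have h2 : Integrable (fun t => 2 * ‖u t‖ ^ p.toReal) μ := (hi u).const_mul 2
  have h3 : Integrable (fun t => η * s * (‖u t‖ ^ p.toReal + ‖v t‖ ^ p.toReal)) μ :=
    ((hi u).add (hi v)).const_mul (η * s)
  rw [← integral_add (hi _) (hi _), ← integral_add (hi u) (hi v), ← integral_const_mul,
    ← integral_const_mul, ← integral_add h2 h3]
  refine integral_mono_ae ((hi _).add (hi _)) (h2.add h3) ?_
  filter_upwards [Lp.coeFn_add u (s • v), Lp.coeFn_sub u (s • v), Lp.coeFn_smul s v]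
    with t e1 e2 e3
  rw [e1, e2, Pi.add_apply, Pi.sub_apply, e3]
  simpa using h (u t) (v t)

theorem isUniformlySmooth_piLp (hp : 1 < p) (hp' : p < ∞) (ι : Type*) [Fintype ι] :
    IsUniformlySmooth (PiLp p fun _ : ι => Lp ℝ p μ) := by
  intro η hη
  obtain ⟨s, hs, h⟩ := Lp_exists_norm_add_rpow_le (μ := μ) hp hp' (half_pos hη)
  have hr := one_lt_toReal hp hp'
  have hr0 : 0 < p.toReal := zero_lt_one.trans hr
  have hn : ∀ w : PiLp p fun _ : ι => Lp ℝ p μ, ‖w‖ ^ p.toReal = ∑ i, ‖w i‖ ^ p.toReal := by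
    intro w
    have : 0 ≤ ∑ i, ‖w i‖ ^ p.toReal := Finset.sum_nonneg fun i _ => by positivity
    rw [PiLp.norm_eq_sum hr0, one_div, Real.rpow_inv_rpow this hr0.ne']
  refine ⟨s, hs, fun u v hu hv => ?_⟩
  have h1 : ‖u + s • v‖ ^ p.toReal + ‖u - s • v‖ ^ p.toReal ≤
      2 * ‖u‖ ^ p.toReal + η / 2 * s * (‖u‖ ^ p.toReal + ‖v‖ ^ p.toReal) := by
    simp_rw [hn]
    rw [← Finset.sum_add_distrib, ← Finset.sum_add_distrib, Finset.mul_sum, Finset.mul_sum,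
      ← Finset.sum_add_distrib]
    exact Finset.sum_le_sum fun i _ => by simpa using h (u i) (v i)
  have h2 : ∀ w : PiLp p fun _ : ι => Lp ℝ p μ, ‖w‖ ≤ 1 → ‖w‖ ^ p.toReal ≤ 1 := fun w hw =>
    Real.rpow_le_one (norm_nonneg w) hw hr0.le
  have h3 : ∀ w : PiLp p fun _ : ι => Lp ℝ p μ, 1 + p.toReal * (‖w‖ - 1) ≤ ‖w‖ ^ p.toReal := by
    intro w
    have := one_add_mul_self_le_rpow_one_add (s := ‖w‖ - 1) (by linarith [norm_nonneg w]) hr.le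
    simpa using this
  have h4 : 2 + p.toReal * (‖u + s • v‖ + ‖u - s • v‖ - 2) ≤ 2 + η * s := by
    have : η / 2 * s * (‖u‖ ^ p.toReal + ‖v‖ ^ p.toReal) ≤ η / 2 * s * 2 := by
      gcongr
      linarith [h2 u hu, h2 v hv]
    linarith [h3 (u + s • v), h3 (u - s • v), h2 u hu]
  by_contra! hcon
  nlinarith [mul_pos hη hs]

end Smooth

/-! ### Finite indices from uniform smoothness -/

section Drop

variable {P Z W : Type*} [TopologicalSpace P] [PseudoMetricSpace Z]
  [NormedAddCommGroup W] [NormedSpace ℝ W]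

theorem exists_apply_gt_of_lt_norm {f : StrongDual ℝ W} {c : ℝ} (h : c < ‖f‖) :
    ∃ u : W, ‖u‖ ≤ 1 ∧ c < f u := by
  by_contra! hcon
  have hc : 0 ≤ c := by simpa using hcon 0 (by simp)
  refine h.not_ge (ContinuousLinearMap.opNorm_le_of_unit_norm hc fun x hx => ?_)
  rw [Real.norm_eq_abs, abs_le]
  have := hcon (-x) (by simp [hx])
  rw [map_neg] at this
  exact ⟨by linarith, hcon x hx.le⟩

/-- A norm-bounded, pointwise continuous family of functionals on a uniformly smooth space that
controls the distances of `q` up to an error less than `ε` forces the derivations along `q` to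
exhaust the parameter set after finitely many steps: each of them lowers the supremum of the norms
by a fixed amount. -/
theorem exists_iter_derivationAlong_eq_empty {q : P → Z} {ε : ℝ} {D : Set P}
    (hW : IsUniformlySmooth W) {G : P → StrongDual ℝ W} (hG : ∀ w, Continuous fun ν => G ν w)
    {K : ℝ} (hK : ∀ ν ∈ D, ‖G ν‖ ≤ K) {c C : ℝ} (hc : c < ε) (hC : 0 ≤ C)
    (h : ∀ ν ∈ D, ∀ ν' ∈ D, dist (q ν) (q ν') ≤ c + C * ‖G ν - G ν'‖) :
    ∃ M : ℕ, iter (derivationAlong q ε) D (M : Ordinal.{u}) = ∅ := by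
  rcases D.eq_empty_or_nonempty with rfl | ⟨ν₀, hν₀⟩
  · exact ⟨0, by simp⟩
  have hK0 : 0 ≤ K := (norm_nonneg _).trans (hK ν₀ hν₀)
  set θ := (ε - c) / (C + 1) with hθ
  have hθ0 : 0 < θ := div_pos (by linarith) (by linarith)
  have hCθ : c + C * θ ≤ ε := by
    have : θ * (C + 1) = ε - c := by rw [hθ]; field_simp
    linarith
  obtain ⟨s, hs, hsm⟩ := hW (θ / (2 * (K + 1))) (by positivity)
  set τ := s * θ / 4 with hτ
  have hτ0 : 0 < τ := by positivity
  have step : ∀ n : ℕ, iter (derivationAlong q ε) (D ∩ {ν | ‖G ν‖ ≤ K - n * τ}) (1 : Ordinal.{u}) ⊆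
      D ∩ {ν | ‖G ν‖ ≤ K - (n + 1 : ℕ) * τ} := by
    intro n ν hν
    rw [← zero_add (1 : Ordinal), iter_add_one, iter_zero] at hν
    refine ⟨hν.1.1, ?_⟩
    by_contra hlt
    rw [mem_ofPred_eq, not_le] at hlt
    push_cast at hlt
    obtain ⟨u, hu, hGu⟩ := exists_apply_gt_of_lt_norm hlt
    refine (hν.2 {ν' | K - (n + 1) * τ < G ν' u}
      ((isOpen_lt continuous_const (hG u)).mem_nhds hGu)).not_ge (Metric.ediam_le ?_)
    rintro _ ⟨ν', ⟨⟨hν'D, hν'n⟩, hν'u⟩, rfl⟩ _ ⟨ν'', ⟨⟨hν''D, hν''n⟩, hν''u⟩, rfl⟩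
    rw [edist_dist]
    refine ENNReal.ofReal_le_ofReal ((h ν' hν'D ν'' hν''D).trans (le_trans ?_ hCθ))
    gcongr
    refine ContinuousLinearMap.opNorm_le_of_unit_norm hθ0.le fun v hv => ?_
    have half : ∀ ν₁ ν₂, ‖G ν₁‖ ≤ K - n * τ → ‖G ν₂‖ ≤ K - n * τ → K - (n + 1) * τ < G ν₁ u →
        K - (n + 1) * τ < G ν₂ u → (G ν₁ - G ν₂) v ≤ θ := by
      intro ν₁ ν₂ h1 h2 hu1 hu2
      set r := K - n * τ with hr
      have hr0 : 0 ≤ r := (norm_nonneg _).trans h1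
      have hrK : r ≤ K := by rw [hr]; nlinarith [(Nat.cast_nonneg n : (0 : ℝ) ≤ n)]
      have e1 : G ν₁ (u + s • v) ≤ r * ‖u + s • v‖ :=
        (le_abs_self _).trans (((G ν₁).le_opNorm _).trans (by gcongr))
      have e2 : G ν₂ (u - s • v) ≤ r * ‖u - s • v‖ :=
        (le_abs_self _).trans (((G ν₂).le_opNorm _).trans (by gcongr))
      have e3 := mul_le_mul_of_nonneg_left (hsm u v hu hv.le) hr0
      rw [map_add, map_smul, smul_eq_mul] at e1
      rw [map_sub, map_smul, smul_eq_mul] at e2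
      have e4 : r * (θ / (2 * (K + 1)) * s) ≤ θ / 2 * s := by
        have : r * (θ / (2 * (K + 1)) * s) = (r / (K + 1)) * (θ / 2 * s) := by field_simp
        rw [this]
        exact mul_le_of_le_one_left (by positivity) (div_le_one_of_le₀ (by linarith) (by linarith))
      have e5 : s * (G ν₁ v - G ν₂ v) ≤ s * θ := by
        have : K - (n + 1) * τ = r - τ := by rw [hr]; ring
        rw [this] at hu1 hu2
        linarith
      exact le_of_mul_le_mul_left e5 hs
    rw [Real.norm_eq_abs, abs_le]
    have hneg := half ν'' ν' hν''n hν'n hν''u hν'u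
    rw [← neg_sub (G ν') (G ν''), neg_apply] at hneg
    exact ⟨by linarith, half ν' ν'' hν'n hν''n hν'u hν''u⟩
  obtain ⟨M, hM⟩ := exists_nat_gt (K / τ)
  refine ⟨M, eq_empty_of_subset_empty fun ν hν => ?_⟩
  have h1 := iter_mul_nat (derivationAlong_subset q ε) (derivationAlong_mono q ε)
    (S := fun n : ℕ => D ∩ {ν | ‖G ν‖ ≤ K - n * τ}) step M
  rw [one_mul] at h1
  have h2 : D ⊆ D ∩ {ν | ‖G ν‖ ≤ K - (0 : ℕ) * τ} := fun ν hν => ⟨hν, by simpa using hK ν hν⟩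
  obtain ⟨-, h3⟩ := h1 (iter_mono (derivationAlong_mono q ε) h2 _ hν)
  rw [div_lt_iff₀ hτ0] at hM
  rw [mem_ofPred_eq] at h3
  linarith [norm_nonneg (G ν)]

end Drop

open BoundedContinuousFunction

/-! ### Positive functionals on `L_p(ℓ_∞(α))` -/

section PosBall

variable {T : Type*} [MeasurableSpace T] {μ : Measure T} {p : ℝ≥0∞} [Fact (1 ≤ p)]
  {α : Type*} [TopologicalSpace α] [DiscreteTopology α]

/-- The function `u ⊗ φ : t ↦ u t • φ` as a continuous linear map in `u`. -/
noncomputable def tensor (μ : Measure T) (p : ℝ≥0∞) [Fact (1 ≤ p)] (φ : α →ᵇ ℝ) :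
    Lp ℝ p μ →L[ℝ] Lp (α →ᵇ ℝ) p μ :=
  (ContinuousLinearMap.toSpanSingleton ℝ φ).compLpL p μ

theorem tensor_ae (φ : α →ᵇ ℝ) (u : Lp ℝ p μ) : tensor μ p φ u =ᵐ[μ] fun t => u t • φ :=
  (ContinuousLinearMap.toSpanSingleton ℝ φ).coeFn_compLpL u

theorem tensor_add (φ ψ : α →ᵇ ℝ) (u : Lp ℝ p μ) :
    tensor μ p (φ + ψ) u = tensor μ p φ u + tensor μ p ψ u := by
  simp only [tensor, ContinuousLinearMap.toSpanSingleton_add, ContinuousLinearMap.add_compLpL]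
  rfl

theorem norm_tensor_le (φ : α →ᵇ ℝ) (u : Lp ℝ p μ) : ‖tensor μ p φ u‖ ≤ ‖φ‖ * ‖u‖ := by
  refine ((tensor μ p φ).le_opNorm u).trans ?_
  gcongr
  exact (ContinuousLinearMap.norm_compLpL_le _).trans
    (ContinuousLinearMap.norm_toSpanSingleton φ).le

theorem tensor_nonneg {φ : α →ᵇ ℝ} (hφ : 0 ≤ φ) {u : Lp ℝ p μ} (hu : 0 ≤ u) :
    0 ≤ tensor μ p φ u := by
  rw [← Lp.coeFn_nonneg] at hu ⊢
  filter_upwards [tensor_ae φ u, hu] with t h1 h2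
  rw [h1]
  exact fun a => mul_nonneg h2 (hφ a)

theorem tensor_mono {φ : α →ᵇ ℝ} (hφ : 0 ≤ φ) {u v : Lp ℝ p μ} (h : u ≤ v) :
    tensor μ p φ u ≤ tensor μ p φ v := by
  have := tensor_nonneg hφ (sub_nonneg.2 h)
  rwa [map_sub, sub_nonneg] at this

/-- The indicator function of a subset of the discrete space `α`. -/
noncomputable def indic (A : Set α) : α →ᵇ ℝ :=
  ofNormedAddCommGroupDiscrete (A.indicator 1) 1 fun x => by
    by_cases h : x ∈ A <;> simp [h]

theorem indic_apply (A : Set α) (x : α) : indic A x = A.indicator 1 x := rfl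

theorem indic_nonneg (A : Set α) : 0 ≤ indic A := fun x => by
  change 0 ≤ A.indicator (1 : α → ℝ) x
  exact indicator_nonneg (fun _ _ => zero_le_one) x

theorem norm_indic_le (A : Set α) : ‖indic A‖ ≤ 1 :=
  (norm_le zero_le_one).2 fun x => by
    by_cases h : x ∈ A <;> simp [h, indic_apply]

theorem indic_union {A B : Set α} (h : Disjoint A B) : indic (A ∪ B) = indic A + indic B := by
  ext x
  simp [indic_apply, indicator_union_of_disjoint h]

theorem indic_add_compl (A : Set α) : indic A + indic Aᶜ = indic univ := by
  rw [← indic_union disjoint_compl_right, union_compl_self]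

/-- The positive part of the dual unit ball of `L_p(ℓ_∞(α))`, with the weak-star topology. -/
def PosBall (α : Type*) [TopologicalSpace α] [DiscreteTopology α] (μ : Measure T) (p : ℝ≥0∞)
    [Fact (1 ≤ p)] : Type _ :=
  {ν : WeakDual ℝ (Lp (α →ᵇ ℝ) p μ) // (∀ Φ, 0 ≤ Φ → 0 ≤ ν Φ) ∧ ∀ Φ, |ν Φ| ≤ ‖Φ‖}

noncomputable instance : TopologicalSpace (PosBall α μ p) := instTopologicalSpaceSubtype

instance : CompactSpace (PosBall α μ p) := by
  refine isCompact_iff_compactSpace.1 ?_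
  have hcl : IsClosed {ν : WeakDual ℝ (Lp (α →ᵇ ℝ) p μ) | (∀ Φ, 0 ≤ Φ → 0 ≤ ν Φ) ∧
      ∀ Φ, |ν Φ| ≤ ‖Φ‖} := by
    simp only [ofPred_and, ofPred_forall]
    exact (isClosed_iInter fun Φ => isClosed_iInter fun _ =>
      isClosed_le continuous_const (WeakDual.eval_continuous Φ)).inter
      (isClosed_iInter fun Φ => isClosed_le (WeakDual.eval_continuous Φ).abs continuous_const)
  refine (WeakDual.isCompact_closedBall (0 : StrongDual ℝ (Lp (α →ᵇ ℝ) p μ)) 1).of_isClosed_subset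
    hcl fun ν hν => ?_
  rw [mem_preimage, mem_closedBall_zero_iff]
  exact ContinuousLinearMap.opNorm_le_bound _ zero_le_one fun Φ => by simpa using hν.2 Φ

namespace PosBall

theorem continuous_apply (Φ : Lp (α →ᵇ ℝ) p μ) : Continuous fun ν : PosBall α μ p => ν.1 Φ :=
  (WeakDual.eval_continuous Φ).comp continuous_subtype_val

theorem mono (ν : PosBall α μ p) {Φ Ψ : Lp (α →ᵇ ℝ) p μ} (h : Φ ≤ Ψ) : ν.1 Φ ≤ ν.1 Ψ := by
  have := ν.2.1 _ (sub_nonneg.2 h)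
  rwa [map_sub, sub_nonneg] at this

theorem abs_apply_le (ν : PosBall α μ p) {Φ Ψ : Lp (α →ᵇ ℝ) p μ} (h1 : -Ψ ≤ Φ) (h2 : Φ ≤ Ψ) :
    |ν.1 Φ| ≤ ν.1 Ψ := by
  have := ν.mono h1
  rw [map_neg] at this
  exact abs_le.2 ⟨this, ν.mono h2⟩

/-- The content of subsets of `Ω` obtained from a positive functional by fixing a weight `k` in
`L_p` and pulling sets back along `j : α → Ω`. -/
noncomputable def content {Ω : Type*} (j : α → Ω) (k : Lp ℝ p μ) (ν : PosBall α μ p) (A : Set Ω) :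
    ℝ :=
  ν.1 (tensor μ p (indic (j ⁻¹' A)) k)

theorem isContentFamily {Ω : Type*} [TopologicalSpace Ω] (j : α → Ω) {k : Lp ℝ p μ} (hk : 0 ≤ k) :
    IsContentFamily (content (α := α) j k) where
  nonneg ν A := ν.2.1 _ (tensor_nonneg (indic_nonneg _) hk)
  union ν A B h := by
    rw [content, preimage_union, indic_union (h.preimage j), tensor_add, map_add]
    rfl
  continuous A := continuous_apply _

/-- The marginal of a positive functional has norm at most `ρ`. -/
def MarginalLE (ν : PosBall α μ p) (ρ : ℝ) : Prop :=
  ∀ u : Lp ℝ p μ, ‖u‖ ≤ 1 → ν.1 (tensor μ p (indic univ) u) ≤ ρ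

theorem marginalLE_one (ν : PosBall α μ p) : ν.MarginalLE 1 := fun _ hu =>
  (le_abs_self _).trans ((ν.2.2 _).trans ((norm_tensor_le _ _).trans
    (mul_le_one₀ (norm_indic_le _) (norm_nonneg _) hu)))

theorem MarginalLE.apply_le {ν : PosBall α μ p} {ρ : ℝ} (h : ν.MarginalLE ρ) (u : Lp ℝ p μ) :
    ν.1 (tensor μ p (indic univ) u) ≤ ρ * ‖u‖ := by
  rcases eq_or_ne u 0 with rfl | hu
  · simp
  have hu0 : 0 < ‖u‖ := norm_pos_iff.2 hu
  have := h (‖u‖⁻¹ • u) (by rw [norm_smul, norm_inv, norm_norm, inv_mul_cancel₀ hu0.ne'])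
  rw [map_smul, map_smul, smul_eq_mul, inv_mul_le_iff₀ hu0] at this
  linarith

/-- If the weight `k` in the unit ball of `L_p` charges `B` with nearly the full norm `ρ` of the
marginal, then the part of the functional that lives off `B` has small norm. -/
theorem apply_tensor_compl_le (hp' : p < ∞) {ν : PosBall α μ p} {ρ : ℝ} (hρ : 0 ≤ ρ) (hρ1 : ρ ≤ 1)
    (h : ν.MarginalLE ρ) {k : Lp ℝ p μ} (hk1 : ‖k‖ ≤ 1) {B : Set α} {κ : ℝ}
    (hB : ρ - κ ≤ ν.1 (tensor μ p (indic B) k)) {s : ℝ} (hs : 0 < s) {u : Lp ℝ p μ}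
    (hu1 : ‖u‖ ≤ 1) :
    ν.1 (tensor μ p (indic Bᶜ) u) ≤ s ^ (p.toReal - 1) + κ / s := by
  have hr0 := toReal_pos_of_lt hp'
  have h1 : s * ν.1 (tensor μ p (indic Bᶜ) u) + ν.1 (tensor μ p (indic B) k) ≤
      ν.1 (tensor μ p (indic univ) (s • u ⊔ k)) := by
    rw [← indic_add_compl B, tensor_add, map_add, add_comm, ← smul_eq_mul, ← map_smul, ← map_smul]
    exact add_le_add (ν.mono (tensor_mono (indic_nonneg _) le_sup_right))
      (ν.mono (tensor_mono (indic_nonneg _) le_sup_left))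
  -- Off `B` the competitor `s • u ⊔ k` gains `s • u` and on `B` it keeps `k`, while its norm
  -- exceeds `1` by at most `s ^ p`.
  have h2 : ‖s • u ⊔ k‖ ^ p.toReal ≤ 1 + s ^ p.toReal := by
    refine (Lp_norm_sup_rpow_le hp' _ _).trans ?_
    rw [norm_smul, Real.norm_of_nonneg hs.le, Real.mul_rpow hs.le (norm_nonneg _), add_comm]
    refine add_le_add (Real.rpow_le_one (norm_nonneg _) hk1 hr0.le) ?_
    exact mul_le_of_le_one_right (by positivity) (Real.rpow_le_one (norm_nonneg _) hu1 hr0.le)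
  have hsr : 0 ≤ s ^ p.toReal := by positivity
  have h3 : ‖s • u ⊔ k‖ ≤ 1 + s ^ p.toReal := by
    rcases le_total ‖s • u ⊔ k‖ 1 with h | h
    · linarith
    · refine le_trans ?_ h2
      refine Real.self_le_rpow_of_one_le h ?_
      rw [← ENNReal.toReal_one]
      exact (ENNReal.toReal_le_toReal ENNReal.one_ne_top hp'.ne).2 Fact.out
  have h4 : ρ * ‖s • u ⊔ k‖ ≤ ρ + s ^ p.toReal := by
    calc ρ * ‖s • u ⊔ k‖ ≤ ρ * (1 + s ^ p.toReal) := by gcongr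
      _ ≤ ρ + s ^ p.toReal := by nlinarith
  have h5 : s * ν.1 (tensor μ p (indic Bᶜ) u) ≤ s * (s ^ (p.toReal - 1) + κ / s) := by
    have e1 : s * (s ^ (p.toReal - 1) + κ / s) = s ^ p.toReal + κ := by
      rw [mul_add, mul_div_cancel₀ _ hs.ne', Real.rpow_sub_one hs.ne', mul_div_cancel₀ _ hs.ne']
    linarith [h.apply_le (s • u ⊔ k)]
  exact le_of_mul_le_mul_left h5 hs

theorem smul_sup_zero {c : ℝ} (hc : 0 < c) (Φ : Lp (α →ᵇ ℝ) p μ) :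
    (c • Φ) ⊔ 0 = c • (Φ ⊔ 0) := by
  apply Lp.ext
  filter_upwards [Lp.coeFn_sup (c • Φ) 0, Lp.coeFn_sup Φ 0, Lp.coeFn_smul c (Φ ⊔ 0),
    Lp.coeFn_smul c Φ, Lp.coeFn_zero (α →ᵇ ℝ) p μ] with t h1 h2 h3 h4 h5
  rw [h1, h3, Pi.sup_apply, Pi.smul_apply, h2, Pi.sup_apply, h4, h5, Pi.smul_apply]
  ext a
  change max (c * Φ t a) 0 = c * max (Φ t a) 0
  rw [mul_max_of_nonneg _ _ hc.le, mul_zero]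

/-- Hahn–Banach extension to a positive functional: a real functional dominated by the norm of the
positive part of `J` factors through `J` and a point of `PosBall`. -/
theorem exists_apply_eq {V : Type*} [AddCommGroup V] [Module ℝ V]
    (J : V →ₗ[ℝ] Lp (α →ᵇ ℝ) p μ) (f : V →ₗ[ℝ] ℝ) (h : ∀ F, f F ≤ ‖J F ⊔ 0‖) :
    ∃ ν : PosBall α μ p, ∀ F, ν.1 (J F) = f F := by
  have hker : LinearMap.ker J ≤ LinearMap.ker f := by
    intro F hF
    rw [LinearMap.mem_ker] at hF ⊢
    have h1 := h F
    have h2 := h (-F)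
    rw [map_neg, map_neg, hF] at h2
    rw [hF] at h1
    simp at h1 h2
    linarith
  set g₀ : LinearMap.range J →ₗ[ℝ] ℝ :=
    ((LinearMap.ker J).liftQ f hker).comp J.quotKerEquivRange.symm.toLinearMap with hg₀
  have hg₀J : ∀ F, g₀ ⟨J F, LinearMap.mem_range_self J F⟩ = f F := by
    intro F
    rw [hg₀, LinearMap.comp_apply, LinearEquiv.coe_coe,
      LinearMap.quotKerEquivRange_symm_apply_image]
    simp
  have hnorm : ∀ Φ Ψ : Lp (α →ᵇ ℝ) p μ, 0 ≤ Φ → Φ ≤ Ψ → ‖Φ‖ ≤ ‖Ψ‖ := fun Φ Ψ h0 h1 =>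
    norm_le_norm_of_abs_le_abs (by rwa [abs_of_nonneg h0, abs_of_nonneg (h0.trans h1)])
  obtain ⟨g, hg, hgN⟩ := exists_extension_of_le_sublinear ⟨LinearMap.range J, g₀⟩
    (fun Φ => ‖Φ ⊔ 0‖)
    (fun c hc Φ => by
      simp only [smul_sup_zero hc, norm_smul, Real.norm_of_nonneg hc.le])
    (fun Φ Ψ => (hnorm _ (Φ ⊔ 0 + Ψ ⊔ 0) le_sup_right (sup_le
      (add_le_add le_sup_left le_sup_left) (add_nonneg le_sup_right le_sup_right))).trans
      (norm_add_le _ _))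
    (by
      rintro ⟨_, F, rfl⟩
      exact (hg₀J F).trans_le (h F))
  have hgle : ∀ Φ, g Φ ≤ ‖Φ‖ := fun Φ => (hgN Φ).trans <| by
    rw [← norm_abs_eq_norm Φ]
    exact hnorm _ _ le_sup_right (sup_le (le_abs_self Φ) (abs_nonneg Φ))
  have habs : ∀ Φ, |g Φ| ≤ ‖Φ‖ := fun Φ => by
    have := hgle (-Φ)
    rw [map_neg, norm_neg] at this
    exact abs_le.2 ⟨by linarith, hgle Φ⟩
  refine ⟨⟨StrongDual.toWeakDual (g.mkContinuous 1 fun Φ => by simpa using habs Φ), ?_, habs⟩,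
    fun F => (hg ⟨J F, LinearMap.mem_range_self J F⟩).trans (hg₀J F)⟩
  intro Φ hΦ
  have := hgN (-Φ)
  rw [sup_eq_right.2 (neg_nonpos.2 hΦ), norm_zero, map_neg] at this
  change 0 ≤ g Φ
  linarith

end PosBall

end PosBall

/-! ### Barycentres of positive functionals -/

section Barycentre

variable {T : Type*} [MeasurableSpace T] {μ : Measure T} {p : ℝ≥0∞} [Fact (1 ≤ p)]
  {α : Type*} [TopologicalSpace α] [DiscreteTopology α]
  {𝕜 : Type*} [RCLike 𝕜] {X : Type*} [NormedAddCommGroup X] [NormedSpace 𝕜 X] [NormedSpace ℝ X]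
  [IsScalarTower ℝ 𝕜 X]

/-- The evaluation `x ↦ (a ↦ Re (j a x))` for a norm-bounded family `j` of functionals. -/
noncomputable def realEval (j : α → WeakDual 𝕜 X) {C : ℝ} (hj : ∀ a x, ‖j a x‖ ≤ C * ‖x‖) :
    X →L[ℝ] (α →ᵇ ℝ) :=
  LinearMap.mkContinuous
    { toFun := fun x => ofNormedAddCommGroupDiscrete (fun a => RCLike.re (j a x)) (C * ‖x‖)
        fun a => (RCLike.norm_re_le_norm _).trans (hj a x)
      map_add' := fun x y => by ext a; simp
      map_smul' := fun c x => by
        ext a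
        simp only [coe_ofNormedAddCommGroupDiscrete, RingHom.id_apply, coe_smul, smul_eq_mul]
        rw [← algebraMap_smul 𝕜 c x, map_smul, smul_eq_mul, RCLike.algebraMap_eq_ofReal,
          RCLike.re_ofReal_mul] } (max C 0)
    fun x => (norm_le (by positivity)).2 fun a =>
      ((RCLike.norm_re_le_norm _).trans (hj a x)).trans (by gcongr; exact le_max_left _ _)

theorem realEval_apply (j : α → WeakDual 𝕜 X) {C : ℝ} (hj : ∀ a x, ‖j a x‖ ≤ C * ‖x‖) (x : X)
    (a : α) : realEval j hj x a = RCLike.re (j a x) := rfl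

/-- The barycentre of a positive functional on `L_p(ℓ_∞(α))` along a bounded family `j` of
functionals on `X`: the functional on `L_p(X)` whose real part is `F ↦ ν (t ↦ Re (j · (F t)))`. -/
noncomputable def barycentre (j : α → WeakDual 𝕜 X) {C : ℝ} (hj : ∀ a x, ‖j a x‖ ≤ C * ‖x‖)
    (ν : PosBall α μ p) : StrongDual 𝕜 (Lp X p μ) :=
  StrongDual.extendRCLikeₗᵢ
    ((WeakDual.toStrongDual ν.1).comp ((realEval j hj).compLpL p μ))

theorem continuous_barycentre (j : α → WeakDual 𝕜 X) {C : ℝ} (hj : ∀ a x, ‖j a x‖ ≤ C * ‖x‖) :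
    Continuous fun ν : PosBall α μ p => StrongDual.toWeakDual (barycentre j hj ν) := by
  have h : Continuous fun ν : PosBall α μ p => StrongDual.toWeakDual
      ((WeakDual.toStrongDual ν.1).comp ((realEval j hj).compLpL p μ)) :=
    WeakDual.continuous_of_continuous_eval fun F => PosBall.continuous_apply _
  exact (WeakDual.extendRCLikeL (𝕜 := 𝕜) (F := Lp X p μ)).continuous.comp h

theorem re_barycentre (j : α → WeakDual 𝕜 X) {C : ℝ} (hj : ∀ a x, ‖j a x‖ ≤ C * ‖x‖)
    (ν : PosBall α μ p) (F : Lp X p μ) :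
    RCLike.re (barycentre j hj ν F) = ν.1 ((realEval j hj).compLpL p μ F) :=
  WeakDual.re_extendRCLikeL_apply_apply (𝕜 := 𝕜) (StrongDual.toWeakDual
      ((WeakDual.toStrongDual ν.1).comp ((realEval j hj).compLpL p μ))) F

theorem dist_barycentre_le (j : α → WeakDual 𝕜 X) {C : ℝ} (hj : ∀ a x, ‖j a x‖ ≤ C * ‖x‖)
    {ν ν' : PosBall α μ p} {c : ℝ} (hc : 0 ≤ c)
    (h : ∀ F, |ν.1 ((realEval j hj).compLpL p μ F) - ν'.1 ((realEval j hj).compLpL p μ F)| ≤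
      c * ‖F‖) : dist (barycentre j hj ν) (barycentre j hj ν') ≤ c := by
  rw [barycentre, barycentre, LinearIsometryEquiv.dist_map, dist_eq_norm]
  exact ContinuousLinearMap.opNorm_le_bound _ hc h

/-- The pointwise norm of an element of `L_p(X)`. -/
noncomputable def normLp {E : Type*} [NormedAddCommGroup E] (F : Lp E p μ) : Lp ℝ p μ :=
  (Lp.memLp F).norm.toLp

theorem normLp_ae {E : Type*} [NormedAddCommGroup E] (F : Lp E p μ) :
    normLp F =ᵐ[μ] fun t => ‖F t‖ := MemLp.coeFn_toLp _

theorem norm_normLp {E : Type*} [NormedAddCommGroup E] (F : Lp E p μ) : ‖normLp F‖ = ‖F‖ := by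
  rw [normLp, Lp.norm_toLp, eLpNorm_norm, Lp.norm_def]

theorem normLp_nonneg {E : Type*} [NormedAddCommGroup E] (F : Lp E p μ) : 0 ≤ normLp F := by
  rw [← Lp.coeFn_nonneg]
  filter_upwards [normLp_ae F] with t ht
  rw [ht]
  exact norm_nonneg _

theorem coeFn_finset_sum {E ι : Type*} [NormedAddCommGroup E] (s : Finset ι) (f : ι → Lp E p μ) :
    ⇑(∑ i ∈ s, f i) =ᵐ[μ] fun t => ∑ i ∈ s, f i t := by
  classical
  induction s using Finset.induction_on with
  | empty =>
    simp only [Finset.sum_empty]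
    exact Lp.coeFn_zero E p μ
  | insert i s hi ih =>
    rw [Finset.sum_insert hi]
    filter_upwards [Lp.coeFn_add (f i) (∑ i ∈ s, f i), ih] with t h1 h2
    rw [h1, Pi.add_apply, h2, Finset.sum_insert hi]

end Barycentre

/-! ### Functionals concentrated near a locally small compact set -/

section Concentrated

variable {T : Type*} [MeasurableSpace T] {μ : Measure T} {p : ℝ≥0∞} [Fact (1 ≤ p)]
  {α : Type*} [TopologicalSpace α] [DiscreteTopology α]
  {𝕜 : Type*} [RCLike 𝕜] {X : Type*} [NormedAddCommGroup X] [NormedSpace 𝕜 X] [NormedSpace ℝ X]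
  [IsScalarTower ℝ 𝕜 X]

/-- The real part of a functional, as a real-linear functional. -/
noncomputable def rePart (y : WeakDual 𝕜 X) : X →L[ℝ] ℝ :=
  RCLike.reCLM.comp ((WeakDual.toStrongDual y).restrictScalars ℝ)

theorem rePart_apply (y : WeakDual 𝕜 X) (x : X) : rePart y x = RCLike.re (y x) := rfl

theorem abs_rePart_sub_le {y z : WeakDual 𝕜 X} {x : X} {c : ℝ} (h : ‖y x - z x‖ ≤ c) :
    |rePart y x - rePart z x| ≤ c := by
  rw [rePart_apply, rePart_apply, ← map_sub]
  exact (RCLike.abs_re_le_norm _).trans h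

/-- The coordinates `F ↦ (Re (y ∘ F))_y` of `F` at finitely many functionals. -/
noncomputable def coordMap (μ : Measure T) (p : ℝ≥0∞) [Fact (1 ≤ p)] (t : Finset (WeakDual 𝕜 X)) :
    Lp X p μ →L[ℝ] PiLp p fun _ : t => Lp ℝ p μ :=
  (PiLp.continuousLinearEquiv p ℝ fun _ : t => Lp ℝ p μ).symm.toContinuousLinearMap.comp
    (ContinuousLinearMap.pi fun y => (rePart y.1).compLpL p μ)

theorem coordMap_apply (t : Finset (WeakDual 𝕜 X)) (F : Lp X p μ) (y : t) :
    coordMap μ p t F y = (rePart y.1).compLpL p μ F := rfl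

/-- The simple `ℓ_∞(α)`-valued function with coordinates `w` on the sets `Q`. -/
noncomputable def stepMap {ι : Type*} [Fintype ι] (μ : Measure T) (p : ℝ≥0∞) [Fact (1 ≤ p)]
    (Q : ι → Set α) : (PiLp p fun _ : ι => Lp ℝ p μ) →L[ℝ] Lp (α →ᵇ ℝ) p μ :=
  ∑ i, (tensor μ p (indic (Q i))).comp (PiLp.proj p (fun _ : ι => Lp ℝ p μ) i)

theorem stepMap_ae {ι : Type*} [Fintype ι] (Q : ι → Set α) (w : PiLp p fun _ : ι => Lp ℝ p μ) :
    stepMap μ p Q w =ᵐ[μ] fun t => ∑ i, w i t • indic (Q i) := by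
  have h : stepMap μ p Q w = ∑ i, tensor μ p (indic (Q i)) (w i) := by
    simp [stepMap]
  rw [h]
  have h2 : ∀ᵐ t ∂μ, ∀ i, tensor μ p (indic (Q i)) (w i) t = w i t • indic (Q i) :=
    ae_all_iff.2 fun i => tensor_ae _ _
  filter_upwards [coeFn_finset_sum Finset.univ fun i => tensor μ p (indic (Q i)) (w i), h2]
    with t h1 h2
  rw [h1]
  exact Finset.sum_congr rfl fun i _ => h2 i

theorem PosBall.apply_tensor_le {ν : PosBall α μ p} {A : Set α} {c : ℝ}
    (h : ∀ u : Lp ℝ p μ, 0 ≤ u → ‖u‖ ≤ 1 → ν.1 (tensor μ p (indic A) u) ≤ c) {u : Lp ℝ p μ}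
    (hu : 0 ≤ u) : ν.1 (tensor μ p (indic A) u) ≤ c * ‖u‖ := by
  rcases eq_or_ne u 0 with rfl | hu'
  · simp
  have hu0 : 0 < ‖u‖ := norm_pos_iff.2 hu'
  have hn : 0 ≤ ‖u‖⁻¹ • u := by
    rw [← Lp.coeFn_nonneg] at hu ⊢
    filter_upwards [hu, Lp.coeFn_smul ‖u‖⁻¹ u] with t h1 h2
    rw [h2]
    exact mul_nonneg (by positivity) h1
  have := h (‖u‖⁻¹ • u) hn (by rw [norm_smul, norm_inv, norm_norm, inv_mul_cancel₀ hu0.ne'])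
  rw [map_smul, map_smul, smul_eq_mul, inv_mul_le_iff₀ hu0] at this
  linarith

/-- If `R` is compact and locally of diameter at most `δ`, and the functionals in `D` live, up to
`ε'` in norm, on every neighbourhood of `R`, then their barycentres are determined, up to a small
error, by finitely many coordinates in `L_p(ℝ)^*`. -/
theorem exists_approx_of_concentrated (hp' : p < ∞) (j : α → WeakDual 𝕜 X) {C : ℝ} (hC : 0 ≤ C)
    (hj : ∀ a x, ‖j a x‖ ≤ C * ‖x‖) {R : Set (WeakDual 𝕜 X)} (hRc : IsCompact R)
    (hRC : ∀ y ∈ R, ∀ x, ‖y x‖ ≤ C * ‖x‖) {δ : ℝ} (hδ : 0 < δ)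
    (hloc : ∀ r ∈ R, ∃ V ∈ 𝓝 r, ∀ y ∈ V ∩ R, ∀ z ∈ V ∩ R, ∀ x, ‖y x - z x‖ ≤ δ * ‖x‖) {ε' : ℝ}
    {D : Set (PosBall α μ p)}
    (hD : ∀ ν ∈ D, ∀ O, IsOpen O → R ⊆ O → ∀ u : Lp ℝ p μ, 0 ≤ u → ‖u‖ ≤ 1 →
      ν.1 (tensor μ p (indic (j ⁻¹' O)ᶜ) u) ≤ ε') :
    ∃ (t : Finset (WeakDual 𝕜 X)) (Q : t → Set α), ∀ ν ∈ D, ∀ F : Lp X p μ,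
      |ν.1 ((realEval j hj).compLpL p μ F - stepMap μ p Q (coordMap μ p t F))| ≤
        (2 * δ + 2 * C * ε') * ‖F‖ := by
  have hcl : ∀ r, ∃ K : Set (WeakDual 𝕜 X), r ∈ R → K ∈ 𝓝 r ∧ IsClosed K ∧
      ∀ y ∈ K ∩ R, ∀ x, ‖y x - r x‖ ≤ δ * ‖x‖ := by
    intro r
    by_cases hr : r ∈ R
    · obtain ⟨V, hV, hVR⟩ := hloc r hr
      obtain ⟨K, hK, hKc, hKV⟩ := exists_mem_nhds_isClosed_subset hV
      exact ⟨K, fun _ => ⟨hK, hKc, fun y hy => hVR y ⟨hKV hy.1, hy.2⟩ r ⟨mem_of_mem_nhds hV, hr⟩⟩⟩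
    · exact ⟨∅, fun h => absurd h hr⟩
  choose K hK using hcl
  obtain ⟨t, htR, hcov⟩ := hRc.elim_nhds_subcover (fun r => interior (K r))
    fun r hr => interior_mem_nhds.2 (hK r hr).1
  have hc : ∀ a, ∃ y, (∃ z ∈ t, j a ∈ K z) → y ∈ t ∧ j a ∈ K y := by
    intro a
    by_cases h : ∃ z ∈ t, j a ∈ K z
    · obtain ⟨z, hz⟩ := h
      exact ⟨z, fun _ => hz⟩
    · exact ⟨0, fun h' => absurd h' h⟩
  choose c hc using hc
  set Q : t → Set α := fun y => {a | (∃ z ∈ t, j a ∈ K z) ∧ c a = y} with hQ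
  refine ⟨t, Q, fun ν hν F => ?_⟩
  have hcont : Continuous fun F : Lp X p μ =>
      ν.1 ((realEval j hj).compLpL p μ F - stepMap μ p Q (coordMap μ p t F)) :=
    (WeakDual.toStrongDual ν.1).continuous.comp
      ((((realEval j hj).compLpL p μ).continuous).sub
        ((stepMap μ p Q).continuous.comp (coordMap μ p t).continuous))
  refine (Lp.simpleFunc.denseRange (E := X) (μ := μ) hp'.ne).induction_on
    (p := fun F => |ν.1 ((realEval j hj).compLpL p μ F - stepMap μ p Q (coordMap μ p t F))| ≤
        (2 * δ + 2 * C * ε') * ‖F‖) F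
    (isClosed_le hcont.abs (continuous_const.mul continuous_norm)) fun f => ?_
  set F : Lp X p μ := f.1 with hF
  set σ := Lp.simpleFunc.toSimpleFunc f with hσ
  -- The neighbourhood of `R` on which the values of `F` see each point of a piece `K y` as `y`.
  set O : Set (WeakDual 𝕜 X) := (⋃ y ∈ t, interior (K y)) ∩
    ⋂ y ∈ t, ⋂ x ∈ σ.range, (K y ∩ {z | x ≠ 0 ∧ 2 * δ * ‖x‖ ≤ |rePart z x - rePart y x|})ᶜ with hO
  have hOo : IsOpen O := by
    refine (isOpen_biUnion fun y _ => isOpen_interior).inter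
      (isOpen_biInter_finset fun y hy => isOpen_biInter_finset fun x _ => ?_)
    rw [isOpen_compl_iff]
    refine (hK y (htR y hy)).2.1.inter ?_
    by_cases hx : x = 0
    · simp [hx]
    · simp only [ne_eq, hx, not_false_eq_true, true_and]
      refine isClosed_le continuous_const (Continuous.abs (Continuous.sub ?_ continuous_const))
      exact RCLike.continuous_re.comp (WeakDual.eval_continuous x)
  have hRO : R ⊆ O := by
    intro r hr
    refine ⟨hcov hr, mem_iInter₂.2 fun y hy => mem_iInter₂.2 fun x _ => ?_⟩
    rintro ⟨hrK, hx, hle⟩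
    have h1 := abs_rePart_sub_le ((hK y (htR y hy)).2.2 r ⟨hrK, hr⟩ x)
    have h2 : 0 < ‖x‖ := norm_pos_iff.2 hx
    nlinarith
  have hsum : ∀ (x : X) (a : α), (∃ z ∈ t, j a ∈ K z) →
      ∑ y : t, rePart y.1 x * indic (Q y) a = rePart (c a) x := by
    intro x a ha
    rw [Finset.sum_eq_single ⟨c a, (hc a ha).1⟩]
    · have : a ∈ Q ⟨c a, (hc a ha).1⟩ := ⟨ha, rfl⟩
      simp [indic_apply, this]
    · intro y _ hy
      have : a ∉ Q y := fun h => hy (Subtype.ext h.2.symm)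
      simp [indic_apply, this]
    · simp
  have hsum0 : ∀ (x : X) (a : α), (¬∃ z ∈ t, j a ∈ K z) →
      ∑ y : t, rePart y.1 x * indic (Q y) a = 0 := by
    intro x a ha
    refine Finset.sum_eq_zero fun y _ => ?_
    have : a ∉ Q y := fun h => ha h.1
    simp [indic_apply, this]
  have hpt : ∀ x ∈ σ.range, ∀ a : α,
      |rePart (j a) x - ∑ y : t, rePart y.1 x * indic (Q y) a| ≤
        2 * δ * ‖x‖ * indic univ a + 2 * C * ‖x‖ * indic (j ⁻¹' O)ᶜ a := by
    intro x hx a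
    have hu : indic (univ : Set α) a = 1 := by simp [indic_apply]
    rw [hu, mul_one]
    have hre : ∀ z : WeakDual 𝕜 X, ‖z x‖ ≤ C * ‖x‖ → |rePart z x| ≤ C * ‖x‖ := fun z hz =>
      (RCLike.abs_re_le_norm _).trans hz
    by_cases haO : j a ∈ O
    · have h0 : indic (j ⁻¹' O)ᶜ a = 0 := by simp [indic_apply, haO]
      rw [h0, mul_zero, add_zero]
      obtain ⟨z, hz, hzK⟩ := mem_iUnion₂.1 haO.1
      have ha : ∃ z ∈ t, j a ∈ K z := ⟨z, hz, interior_subset hzK⟩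
      rw [hsum x a ha]
      by_cases hx0 : x = 0
      · simp [hx0]
      · have := mem_iInter₂.1 (mem_iInter₂.1 haO.2 (c a) (hc a ha).1) x hx
        by_contra! hcon
        exact this ⟨(hc a ha).2, hx0, hcon.le⟩
    · have h1 : indic (j ⁻¹' O)ᶜ a = 1 := by simp [indic_apply, haO]
      rw [h1, mul_one]
      have h2 := hre (j a) (hj a x)
      have h3 : |∑ y : t, rePart y.1 x * indic (Q y) a| ≤ C * ‖x‖ := by
        by_cases ha : ∃ z ∈ t, j a ∈ K z
        · rw [hsum x a ha]
          exact hre _ (hRC _ (htR _ (hc a ha).1) x)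
        · rw [hsum0 x a ha, abs_zero]
          positivity
      have h4 : 0 ≤ δ * ‖x‖ := by positivity
      linarith [abs_sub (rePart (j a) x) (∑ y : t, rePart y.1 x * indic (Q y) a)]
  set Ψ : Lp (α →ᵇ ℝ) p μ := tensor μ p (indic univ) ((2 * δ) • normLp F) +
    tensor μ p (indic (j ⁻¹' O)ᶜ) ((2 * C) • normLp F) with hΨ
  have hΨle : ν.1 Ψ ≤ (2 * δ + 2 * C * ε') * ‖F‖ := by
    have h1 := ν.marginalLE_one.apply_le (normLp F)
    have h2 := PosBall.apply_tensor_le (hD ν hν O hOo hRO) (normLp_nonneg F)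
    rw [norm_normLp] at h1 h2
    rw [hΨ, map_add, map_smul, map_smul, map_smul, map_smul, smul_eq_mul, smul_eq_mul]
    nlinarith
  have hae : ∀ᵐ s ∂μ, ∀ a : α,
      |((realEval j hj).compLpL p μ F - stepMap μ p Q (coordMap μ p t F)) s a| ≤ Ψ s a := by
    have hco : ∀ᵐ s ∂μ, ∀ y : t, coordMap μ p t F y s = rePart y.1 (F s) :=
      ae_all_iff.2 fun y => by
        rw [coordMap_apply]
        exact (rePart y.1).coeFn_compLpL F
    filter_upwards [Lp.coeFn_sub ((realEval j hj).compLpL p μ F)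
      (stepMap μ p Q (coordMap μ p t F)), (realEval j hj).coeFn_compLpL F,
      stepMap_ae Q (coordMap μ p t F), hco, Lp.simpleFunc.toSimpleFunc_eq_toFun f,
      Lp.coeFn_add (tensor μ p (indic univ) ((2 * δ) • normLp F))
        (tensor μ p (indic (j ⁻¹' O)ᶜ) ((2 * C) • normLp F)),
      tensor_ae (α := α) (indic univ) ((2 * δ) • normLp F),
      tensor_ae (α := α) (indic (j ⁻¹' O)ᶜ) ((2 * C) • normLp F),
      Lp.coeFn_smul (2 * δ) (normLp F), Lp.coeFn_smul (2 * C) (normLp F), normLp_ae F]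
      with s e1 e2 e3 e4 e5 e6 e7 e8 e9 e10 e11 a
    have hFs : F s ∈ σ.range := by
      rw [hF, ← e5]
      exact SimpleFunc.mem_range_self _ _
    have := hpt (F s) hFs a
    rw [e1, Pi.sub_apply, e2, e3, e6, Pi.add_apply, e7, e8, e9, e10, Pi.smul_apply, Pi.smul_apply,
      e11]
    simp only [e4]
    simpa [realEval_apply, rePart_apply, BoundedContinuousFunction.sum_apply] using this
  suffices hle : -Ψ ≤ (realEval j hj).compLpL p μ F - stepMap μ p Q (coordMap μ p t F) ∧
      (realEval j hj).compLpL p μ F - stepMap μ p Q (coordMap μ p t F) ≤ Ψ from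
    (ν.abs_apply_le hle.1 hle.2).trans hΨle
  constructor
  · rw [← Lp.coeFn_le]
    filter_upwards [hae, Lp.coeFn_neg Ψ] with s h1 h2
    rw [h2]
    exact fun a => (abs_le.1 (h1 a)).1
  · rw [← Lp.coeFn_le]
    filter_upwards [hae] with s h1
    exact fun a => (abs_le.1 (h1 a)).2

/-- Families of positive functionals that concentrate near a compact, locally small set have finite
index. -/
theorem exists_iter_of_concentrated (hp : 1 < p) (hp' : p < ∞) (j : α → WeakDual 𝕜 X) {C : ℝ}
    (hC : 0 ≤ C) (hj : ∀ a x, ‖j a x‖ ≤ C * ‖x‖) {R : Set (WeakDual 𝕜 X)} (hRc : IsCompact R)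
    (hRC : ∀ y ∈ R, ∀ x, ‖y x‖ ≤ C * ‖x‖) {δ : ℝ} (hδ : 0 < δ)
    (hloc : ∀ r ∈ R, ∃ V ∈ 𝓝 r, ∀ y ∈ V ∩ R, ∀ z ∈ V ∩ R, ∀ x, ‖y x - z x‖ ≤ δ * ‖x‖) {ε' : ℝ}
    (hε' : 0 ≤ ε') {D : Set (PosBall α μ p)}
    (hD : ∀ ν ∈ D, ∀ O, IsOpen O → R ⊆ O → ∀ u : Lp ℝ p μ, 0 ≤ u → ‖u‖ ≤ 1 →
      ν.1 (tensor μ p (indic (j ⁻¹' O)ᶜ) u) ≤ ε') {ε : ℝ} (hε : 2 * (2 * δ + 2 * C * ε') < ε) :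
    ∃ M : ℕ, iter (derivationAlong (barycentre j hj) ε) D (M : Ordinal.{u}) = ∅ := by
  obtain ⟨t, Q, h⟩ := exists_approx_of_concentrated hp' j hC hj hRc hRC hδ hloc hD
  set G : PosBall α μ p → StrongDual ℝ (PiLp p fun _ : t => Lp ℝ p μ) := fun ν =>
    (WeakDual.toStrongDual ν.1).comp (stepMap μ p Q) with hG
  refine exists_iter_derivationAlong_eq_empty (isUniformlySmooth_piLp hp hp' t) (G := G)
    (fun w => PosBall.continuous_apply _) (K := ‖stepMap μ p Q‖) (fun ν _ => ?_) hε
    (C := ‖coordMap μ p t‖) (norm_nonneg _) fun ν hν ν' hν' => ?_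
  · refine (ContinuousLinearMap.opNorm_comp_le _ _).trans
      (mul_le_of_le_one_left (norm_nonneg _) ?_)
    exact ContinuousLinearMap.opNorm_le_bound _ zero_le_one fun Φ => by simpa using ν.2.2 Φ
  · refine dist_barycentre_le j hj (by positivity) fun F => ?_
    have h1 := h ν hν F
    have h2 := h ν' hν' F
    have h3 : |(G ν - G ν') (coordMap μ p t F)| ≤ ‖G ν - G ν'‖ * (‖coordMap μ p t‖ * ‖F‖) :=
      ((G ν - G ν').le_opNorm _).trans (by gcongr; exact (coordMap μ p t).le_opNorm F)
    have h4 : (G ν - G ν') (coordMap μ p t F) = ν.1 (stepMap μ p Q (coordMap μ p t F)) -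
      ν'.1 (stepMap μ p Q (coordMap μ p t F)) := rfl
    rw [h4] at h3
    rw [map_sub] at h1 h2
    rw [abs_le] at h1 h2 h3 ⊢
    constructor <;> nlinarith

end Concentrated

/-! ### The levels of a weak-star compact set -/

section Levels

variable {𝕜 : Type} [RCLike 𝕜] {X : Type u} [NormedAddCommGroup X] [NormedSpace 𝕜 X]

/-- The Szlenk derivates of `L` as subsets of the weak-star dual. -/
noncomputable def level (L : Set (StrongDual 𝕜 X)) (δ : ℝ) (ξ : Ordinal.{v}) :
    Set (WeakDual 𝕜 X) :=
  iter (derivationAlong WeakDual.toStrongDual δ) (WeakDual.toStrongDual ⁻¹' L) ξ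

theorem level_eq (L : Set (StrongDual 𝕜 X)) (δ : ℝ) (ξ : Ordinal.{v}) :
    level L δ ξ = WeakDual.toStrongDual ⁻¹' iter (derivation δ) L ξ := by
  have h : ∀ S : Set (StrongDual 𝕜 X), derivationAlong WeakDual.toStrongDual δ
      (WeakDual.toStrongDual ⁻¹' S) = WeakDual.toStrongDual ⁻¹' derivation δ S := by
    intro S
    have h1 : ∀ V : Set (WeakDual 𝕜 X),
        WeakDual.toStrongDual '' (WeakDual.toStrongDual ⁻¹' S ∩ V) =
          S ∩ StrongDual.toWeakDual ⁻¹' V := by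
      intro V
      ext y
      constructor
      · rintro ⟨z, hz, rfl⟩
        exact hz
      · exact fun hy => ⟨StrongDual.toWeakDual y, hy, rfl⟩
    ext x
    simp only [derivationAlong, h1]
    rfl
  induction ξ using Ordinal.limitRecOn with
  | zero => simp [level]
  | add_one ξ ih =>
    rw [level] at ih ⊢
    rw [iter_add_one, iter_add_one, ih, h]
  | limit ξ hξ ih =>
    rw [level, iter_limit _ _ hξ, iter_limit _ _ hξ, preimage_iInter₂]
    exact iInter₂_congr ih

variable {L : Set (StrongDual 𝕜 X)}

theorem level_isClosed (hL : IsCompact (StrongDual.toWeakDual '' L)) (δ : ℝ) (ξ : Ordinal.{v}) :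
    IsClosed (level L δ ξ) := by
  refine iter_isClosed (derivationAlong_isClosed _ δ) ?_ ξ
  rw [← LinearEquiv.image_symm_eq_preimage]
  exact hL.isClosed

theorem isLevelFamily_level (hL : IsCompact (StrongDual.toWeakDual '' L)) {δ : ℝ} (hδ : 0 < δ) :
    IsLevelFamily (fun S : Set (WeakDual 𝕜 X) => ∀ y ∈ S, ∀ z ∈ S, ∀ x, ‖y x - z x‖ ≤ δ * ‖x‖)
      (level.{u, v} L δ) := by
  have hpre : IsCompact (WeakDual.toStrongDual ⁻¹' L) := by
    rw [← LinearEquiv.image_symm_eq_preimage]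
    exact hL
  constructor
  · exact fun ξ ζ h => iter_antitone (derivationAlong_subset _ _) h
  · exact fun ξ => hpre.of_isClosed_subset (level_isClosed hL δ ξ)
      (iter_subset (derivationAlong_subset _ _) ξ)
  · exact fun ξ hξ O hO h => exists_iter_subset_of_limit (derivationAlong_subset _ _)
      (derivationAlong_isClosed _ δ) hpre hpre.isClosed hξ hO h
  · intro ξ x hx hx1
    rw [level, iter_add_one] at hx1
    have : ∃ V ∈ 𝓝 x, Metric.ediam (WeakDual.toStrongDual '' (level L δ ξ ∩ V)) ≤
        ENNReal.ofReal δ := by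
      by_contra! h
      exact hx1 ⟨hx, h⟩
    obtain ⟨V, hV, hd⟩ := this
    refine ⟨V, hV, fun y hy z hz w => ?_⟩
    have h1 := (Metric.edist_le_ediam_of_mem (mem_image_of_mem WeakDual.toStrongDual hy.symm)
      (mem_image_of_mem WeakDual.toStrongDual hz.symm)).trans hd
    rw [edist_dist, ENNReal.ofReal_le_ofReal_iff hδ.le, dist_eq_norm] at h1
    exact ((WeakDual.toStrongDual y - WeakDual.toStrongDual z).le_opNorm w).trans (by gcongr)
  · exact fun A B hAB hB y hy z hz => hB y (hAB hy) z (hAB hz)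

end Levels

/-! ### The upper estimate -/

section Upper

variable {𝕜 : Type} [RCLike 𝕜] {X : Type u} [NormedAddCommGroup X] [NormedSpace 𝕜 X]
  {Y : Type v} [NormedAddCommGroup Y] [NormedSpace 𝕜 Y]

theorem mem_adjointBall {A : X →L[𝕜] Y} {x : StrongDual 𝕜 X} :
    x ∈ adjointBall A ↔ ∃ y : StrongDual 𝕜 Y, ‖y‖ ≤ 1 ∧ y.comp A = x := by
  simp [adjointBall]

theorem isCompact_adjointBall (A : X →L[𝕜] Y) :
    IsCompact (StrongDual.toWeakDual '' adjointBall A) := by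
  have hcont : Continuous fun y : WeakDual 𝕜 Y =>
      StrongDual.toWeakDual ((WeakDual.toStrongDual y).comp A) :=
    WeakDual.continuous_of_continuous_eval fun x => WeakDual.eval_continuous (A x)
  have := (WeakDual.isCompact_closedBall (0 : StrongDual 𝕜 Y) 1).image hcont
  convert! this using 1
  ext z
  constructor
  · rintro ⟨_, ⟨y, hy, rfl⟩, rfl⟩
    exact ⟨StrongDual.toWeakDual y, hy, rfl⟩
  · rintro ⟨y, hy, rfl⟩
    exact ⟨_, ⟨WeakDual.toStrongDual y, hy, rfl⟩, rfl⟩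

/-- The closed unit ball of the dual of `Y` as a discrete space, so that all bounded functions on it
are continuous. -/
def DualBall (𝕜 : Type) [RCLike 𝕜] (Y : Type v) [NormedAddCommGroup Y] [NormedSpace 𝕜 Y] : Type v :=
  {y : StrongDual 𝕜 Y // ‖y‖ ≤ 1}

instance : TopologicalSpace (DualBall 𝕜 Y) := ⊥

instance : DiscreteTopology (DualBall 𝕜 Y) := ⟨rfl⟩

/-- The restriction of the adjoint of `A` to the dual unit ball. -/
noncomputable def adjointPoint (A : X →L[𝕜] Y) (y : DualBall 𝕜 Y) : WeakDual 𝕜 X :=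
  StrongDual.toWeakDual (y.1.comp A)

theorem adjointPoint_apply (A : X →L[𝕜] Y) (y : DualBall 𝕜 Y) (x : X) :
    adjointPoint A y x = y.1 (A x) := rfl

theorem norm_adjointPoint_le (A : X →L[𝕜] Y) (y : DualBall 𝕜 Y) (x : X) :
    ‖adjointPoint A y x‖ ≤ ‖A‖ * ‖x‖ := by
  rw [adjointPoint_apply]
  calc ‖y.1 (A x)‖ ≤ ‖y.1‖ * ‖A x‖ := y.1.le_opNorm _
    _ ≤ 1 * (‖A‖ * ‖x‖) := by
      gcongr
      · exact y.2
      · exact A.le_opNorm x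
    _ = ‖A‖ * ‖x‖ := one_mul _

theorem adjointPoint_mem_level_zero (A : X →L[𝕜] Y) (δ : ℝ) (y : DualBall 𝕜 Y) :
    adjointPoint A y ∈ level (adjointBall A) δ (0 : Ordinal.{u}) := by
  rw [level_eq, iter_zero, mem_preimage, mem_adjointBall]
  exact ⟨y.1, y.2, rfl⟩

variable [NormedSpace ℝ X] [IsScalarTower ℝ 𝕜 X] {p : ℝ≥0∞} [Fact (1 ≤ p)]

/-- By Hahn–Banach some functional in the dual unit ball attains the norm of `A x`. -/
theorem norm_apply_le_norm_realEval_sup (A : X →L[𝕜] Y) (x : X) :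
    ‖A x‖ ≤ ‖realEval (adjointPoint A) (norm_adjointPoint_le A) x ⊔ 0‖ := by
  obtain ⟨y, hy, hyA⟩ := exists_dual_vector'' 𝕜 (A x)
  set Φ := realEval (adjointPoint A) (norm_adjointPoint_le A) x ⊔ 0 with hΦ
  have h1 : Φ ⟨y, hy⟩ = max (RCLike.re (y (A x))) 0 := rfl
  have h2 := Φ.norm_coe_le_norm ⟨y, hy⟩
  rwa [h1, hyA, RCLike.ofReal_re, max_eq_left (norm_nonneg _), norm_norm] at h2

/-- Every functional in `A_p^* B` is the barycentre of a positive functional. -/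
theorem adjointBall_pointwiseOp_subset (A : X →L[𝕜] Y) :
    adjointBall (pointwiseOp p A) ⊆
      range (barycentre (μ := (volume : Measure unitInterval)) (p := p) (adjointPoint A)
        (norm_adjointPoint_le A)) := by
  intro f hf
  obtain ⟨g, hg, rfl⟩ := mem_adjointBall.1 hf
  set J := (realEval (adjointPoint A) (norm_adjointPoint_le A)).compLpL p
    (volume : Measure unitInterval) with hJ
  have hdom : ∀ F : LpSpace p X, ‖pointwiseOp p A F‖ ≤ ‖J F ⊔ 0‖ := by
    intro F
    refine Lp.norm_le_norm_of_ae_le ?_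
    have e1 : pointwiseOp p A F =ᵐ[volume] fun s => A (F s) := A.coeFn_compLpL F
    filter_upwards [e1, Lp.coeFn_sup (J F) 0,
      (realEval (adjointPoint A) (norm_adjointPoint_le A)).coeFn_compLpL F,
      Lp.coeFn_zero (DualBall 𝕜 Y →ᵇ ℝ) p (volume : Measure unitInterval)] with s e1 e2 e3 e4
    rw [e1, e2, Pi.sup_apply, hJ, e3, e4]
    exact norm_apply_le_norm_realEval_sup A (F s)
  obtain ⟨ν, hν⟩ := PosBall.exists_apply_eq J.toLinearMap
    (rePart (StrongDual.toWeakDual (g.comp (pointwiseOp p A)))).toLinearMap (fun F =>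
      (RCLike.re_le_norm _).trans (((g.le_opNorm _).trans
        (mul_le_of_le_one_left (norm_nonneg _) hg)).trans (hdom F)))
  refine ⟨ν, ?_⟩
  have hre : ∀ F, RCLike.re (barycentre (adjointPoint A) (norm_adjointPoint_le A) ν F) =
      RCLike.re (g.comp (pointwiseOp p A) F) := fun F =>
    (re_barycentre _ _ ν F).trans (hν F)
  refine ContinuousLinearMap.ext fun F => RCLike.ext (hre F) ?_
  have := hre ((RCLike.I : 𝕜) • F)
  rw [ContinuousLinearMap.map_smul, ContinuousLinearMap.map_smul, smul_eq_mul, smul_eq_mul,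
    RCLike.I_mul_re, RCLike.I_mul_re] at this
  linarith

/-- If `ω ^ a` derivations exhaust `A^* B` at every scale, then `ω * ω ^ a` derivations along
barycentres exhaust the space of positive functionals. -/
theorem iter_posBall_eq_empty (hp : 1 < p) (hp' : p < ∞) (A : X →L[𝕜] Y) {a : Ordinal.{u}}
    (h : ∀ δ : ℝ, 0 < δ → iter (derivation δ) (adjointBall A) (ω ^ a) = ∅) {ε : ℝ} (hε : 0 < ε) :
    iter (derivationAlong (barycentre (μ := (volume : Measure unitInterval)) (p := p)
      (adjointPoint A) (norm_adjointPoint_le A)) ε) univ (ω * ω ^ a) = ∅ := by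
  set d := derivationAlong (barycentre (μ := (volume : Measure unitInterval)) (p := p)
      (adjointPoint A) (norm_adjointPoint_le A)) ε with hd_def
  have hd : IsLocalDerivation d :=
    ⟨derivationAlong_subset _ _, derivationAlong_mono _ _, derivationAlong_inter _ _⟩
  set δ := ε / 16 with hδ
  have hδ0 : 0 < δ := by positivity
  set ε' := ε / (16 * (‖A‖ + 1)) with hε'
  have hε'0 : 0 < ε' := by positivity
  have hbound : 2 * (2 * δ + 2 * ‖A‖ * ε') < ε := by
    have h1 : ‖A‖ * ε' ≤ ε / 16 := by
      have : ‖A‖ * ε' = ‖A‖ / (‖A‖ + 1) * (ε / 16) := by rw [hε']; field_simp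
      rw [this]
      exact mul_le_of_le_one_left (by positivity)
        (div_le_one_of_le₀ (by linarith) (by positivity))
    linarith
  set Lev : Ordinal.{u} → Set (WeakDual 𝕜 X) := level (adjointBall A) δ with hLev_def
  have hLev := isLevelFamily_level.{u, u} (isCompact_adjointBall A) hδ0
  have hLev0 : ∀ y ∈ Lev 0, ∀ x, ‖y x‖ ≤ ‖A‖ * ‖x‖ := by
    intro y hy x
    rw [hLev_def, level_eq, iter_zero, mem_preimage, mem_adjointBall] at hy
    obtain ⟨g, hg, hgy⟩ := hy
    have : y = adjointPoint A ⟨g, hg⟩ := WeakDual.toStrongDual.injective hgy.symm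
    rw [this]
    exact norm_adjointPoint_le A _ x
  have hempty : Lev (ω ^ a) = ∅ := by
    rw [hLev_def, level_eq, h δ hδ0, preimage_empty]
  have hpre : ∀ O : Set (WeakDual 𝕜 X), Lev 0 ⊆ O → adjointPoint A ⁻¹' O = univ := fun O hO =>
    eq_univ_of_forall fun y => hO (adjointPoint_mem_level_zero A δ y)
  rcases eq_or_ne a 0 with rfl | ha
  · -- One derivation exhausts the levels, so the whole of `A^* B` is locally small.
    rw [Ordinal.opow_zero] at hempty
    obtain ⟨M, hM⟩ := exists_iter_of_concentrated.{u} (μ := (volume : Measure unitInterval)) hp hp'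
      (adjointPoint A) (norm_nonneg A) (norm_adjointPoint_le A) (hLev.isCompact 0) hLev0 hδ0
      (fun r hr => by
        obtain ⟨V, hV, hVs⟩ := hLev.locally_small 0 r hr (by
          rw [zero_add]
          exact fun hr1 => (hempty ▸ hr1 : r ∈ (∅ : Set (WeakDual 𝕜 X))))
        exact ⟨V, hV, hVs⟩)
      hε'0.le (D := univ) (fun ν _ O _ hO u _ _ => by
        have h0 : indic (∅ : Set (DualBall 𝕜 Y)) = 0 := by
          ext y
          simp [indic_apply]
        have h1 : tensor (volume : Measure unitInterval) p (indic (∅ : Set (DualBall 𝕜 Y))) u = 0 :=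
          norm_le_zero_iff.1 ((norm_tensor_le _ _).trans (by simp [h0]))
        rw [hpre O hO, compl_univ, h1, map_zero]
        exact hε'0.le) hbound
    refine eq_empty_of_subset_empty ((iter_antitone hd.subset ?_).trans hM.subset)
    rw [Ordinal.opow_zero, mul_one]
    exact (Ordinal.natCast_lt_omega0 M).le
  obtain ⟨η, hη, hηe⟩ := hLev.limit (ω ^ a)
    (Ordinal.isSuccLimit_opow_left Ordinal.isSuccLimit_omega0 ha) ∅ isOpen_empty hempty.subset
  obtain ⟨c, hca, n, hn⟩ := (Ordinal.lt_omega0_opow ha).1 hη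
  have hn0 : 0 < n := by
    rcases Nat.eq_zero_or_pos n with rfl | h
    · simp at hn
    · exact h
  have hLevn : Lev (0 + ω ^ c * n) = ∅ := by
    rw [zero_add]
    exact eq_empty_of_subset_empty ((hLev.antitone hn.le).trans hηe)
  have hr := one_lt_toReal hp hp'
  -- With these `s` and `κ` the bound `apply_tensor_compl_le` is `ε'`.
  set s := (ε' / 2) ^ (p.toReal - 1)⁻¹ with hs
  have hs0 : 0 < s := Real.rpow_pos_of_pos (by positivity) _
  set κ := s * (ε' / 2) with hκ
  have hκ0 : 0 < κ := by positivity
  have hsκ : s ^ (p.toReal - 1) + κ / s ≤ ε' := by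
    rw [hs, Real.rpow_inv_rpow (by positivity) (by linarith), ← hs, hκ,
      mul_div_cancel_left₀ _ hs0.ne']
    linarith
  set S : ℝ → Set (PosBall (DualBall 𝕜 Y) (volume : Measure unitInterval) p) :=
    fun ρ => {ν | ν.MarginalLE ρ} with hS
  obtain ⟨l, hl⟩ := exists_iter_of_isPinned_mul (Ω := WeakDual 𝕜 X) (Lev := Lev) hd 1 c Unit hn0
    (half_pos hκ0)
  set β := ω * ω ^ c * (l : Ordinal.{u}) with hβ
  have hround : ∀ ρ ≤ 1, iter d (S ρ) β ⊆ S (ρ - κ / 4) := by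
    intro ρ hρ1 ν hν u hu
    by_contra! hcon
    have hνS : ν.MarginalLE ρ := iter_subset hd.subset _ hν
    have hρ0 : 0 ≤ ρ := by simpa using hνS 0 (by simp)
    -- The weight `|u|` nearly norms the marginal of every functional in a neighbourhood of `ν`.
    set k : Lp ℝ p (volume : Measure unitInterval) := |u| with hk
    have hk0 : 0 ≤ k := abs_nonneg u
    have hk1 : ‖k‖ ≤ 1 := by rwa [hk, norm_abs_eq_norm]
    have hm := PosBall.isContentFamily (μ := (volume : Measure unitInterval)) (p := p)
      (adjointPoint A) hk0
    set m := PosBall.content (adjointPoint A) k with hm_def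
    set U : Set (PosBall (DualBall 𝕜 Y) (volume : Measure unitInterval) p) :=
      {ν' | ρ - κ / 4 < ν'.1 (tensor volume p (indic univ) k)} with hU
    have hUo : IsOpen U := isOpen_lt continuous_const (PosBall.continuous_apply _)
    have hνU : ν ∈ U := hcon.trans_le (ν.mono (tensor_mono (indic_nonneg _) (le_abs_self u)))
    have hbase : ExhaustsConcentrated m
        (fun S : Set (WeakDual 𝕜 X) => ∀ y ∈ S, ∀ z ∈ S, ∀ x, ‖y x - z x‖ ≤ δ * ‖x‖) Lev d (S ρ)
        (ρ - κ) := by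
      intro D R hD hRc hR0 hloc hconc
      refine exists_iter_of_concentrated.{u} hp hp' (adjointPoint A) (norm_nonneg A)
        (norm_adjointPoint_le A) hRc (fun y hy => hLev0 y (hR0 hy)) hδ0 hloc hε'0.le ?_ hbound
      intro ν' hν' O hO hRO w _ hw
      exact (PosBall.apply_tensor_compl_le hp' hρ0 hρ1 (hD hν') hk1
        (hconc ν' hν' O hO hRO).le hs0 hw).trans hsκ
    have hmC : ∀ ν' ∈ S ρ, m ν' univ ≤ 1 := fun ν' hν' => (hν' k hk1).trans hρ1
    refine hd.notMem_iter hUo (hl m (S ρ) (ρ - κ) hm hmC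
      (iter_of_isPinned_opow hm hLev hd hmC hbase c) (S ρ ∩ U) (fun _ => 0)
      (fun _ => ρ - κ / 4) (fun _ => 0) inter_subset_left ⟨?_, ?_, ?_⟩) le_rfl hνU hν
    · exact fun i j hij => absurd (Subsingleton.elim i j) hij
    · rintro ν' ⟨-, hν'U⟩ -
      constructor
      · refine IsContentFamily.le_outer fun O _ hO => ?_
        change _ ≤ ν'.1 (tensor volume p (indic (adjointPoint A ⁻¹' O)) k)
        rw [hpre O hO]
        exact hν'U.le
      · rw [hLevn]
        exact (hm.outer_le ν' isOpen_empty subset_rfl).trans_eq (hm.empty ν')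
    · simp only [Finset.univ_unique, Finset.sum_const, Finset.card_singleton, one_smul]
      linarith
  obtain ⟨N, hN⟩ := exists_nat_gt (1 / (κ / 4))
  rw [div_lt_iff₀ (by positivity)] at hN
  have hall := iter_mul_nat hd.subset hd.mono (S := fun i : ℕ => S (1 - i * (κ / 4))) (ξ := β)
    (fun i => (hround _ (sub_le_self _ (by positivity))).trans_eq (by
      push_cast
      ring_nf)) N
  refine eq_empty_of_subset_empty fun ν hν => ?_
  have hβa : β * N ≤ ω * ω ^ a := by
    rw [hβ, mul_assoc, mul_assoc, ← Ordinal.natCast_mul]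
    gcongr
    exact (Ordinal.opow_mul_lt_opow (Ordinal.natCast_lt_omega0 _) hca).le
  have hν1 := iter_antitone hd.subset hβa hν
  have huniv : univ ⊆ S (1 - (0 : ℕ) * (κ / 4)) := fun ν' _ => by
    simpa [hS] using ν'.marginalLE_one
  have hν2 : ν.MarginalLE (1 - N * (κ / 4)) := hall (iter_mono hd.mono huniv _ hν1)
  have := hν2 0 (by simp)
  rw [map_zero, map_zero] at this
  linarith

end Upper

/-- If `ω ^ a` Szlenk derivations exhaust `A^* B` at every scale, then `ω * ω ^ a` of them exhaust
`A_p^* B`. -/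
theorem iter_adjointBall_pointwiseOp {𝕜 : Type} [RCLike 𝕜]
    {X : Type u} [NormedAddCommGroup X] [NormedSpace 𝕜 X]
    {Y : Type v} [NormedAddCommGroup Y] [NormedSpace 𝕜 Y] {p : ℝ≥0∞} [Fact (1 ≤ p)]
    (hp : 1 < p) (hp' : p < ∞) (A : X →L[𝕜] Y) {a : Ordinal.{u}}
    (h : ∀ δ : ℝ, 0 < δ → iter (derivation δ) (adjointBall A) (ω ^ a) = ∅) {ε : ℝ} (hε : 0 < ε) :
    iter (derivation ε) (adjointBall (pointwiseOp p A)) (ω * ω ^ a) = ∅ := by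
  let : NormedSpace ℝ X := NormedSpace.restrictScalars ℝ 𝕜 X
  have : IsScalarTower ℝ 𝕜 X := IsScalarTower.of_algebraMap_smul fun r x => rfl
  refine eq_empty_of_subset_empty ((iter_mono (derivation_mono ε)
    (adjointBall_pointwiseOp_subset A) _).trans
    ((iterDerivation_image_subset (q := barycentre (adjointPoint A) (norm_adjointPoint_le A))
      (continuous_barycentre _ _) hε _).trans ?_))
  rw [iter_posBall_eq_empty hp hp' A h (half_pos hε), image_empty]

/-! ### The Szlenk index and the iterated derivations -/

section Index

variable {𝕜 : Type} [RCLike 𝕜] {X : Type u} [NormedAddCommGroup X] [NormedSpace 𝕜 X]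
  {L : Set (StrongDual 𝕜 X)}

theorem indexEps_le_iff {ε : ℝ} {ξ : Ordinal.{u}} :
    indexEps L ε ≤ (ξ : WithTop Ordinal.{u}) ↔ iter (derivation ε) L ξ = ∅ := by
  refine ⟨fun h => ?_, fun h => sInf_le (mem_image_of_mem _ h)⟩
  have hne : ((fun ξ : Ordinal.{u} => (ξ : WithTop Ordinal.{u})) ''
      {ξ | iterDerivation ε L ξ = ∅}).Nonempty := by
    by_contra hne
    rw [not_nonempty_iff_eq_empty] at hne
    rw [indexEps, hne, sInf_empty] at h
    exact WithTop.coe_ne_top (top_le_iff.1 h)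
  obtain ⟨ζ, hζ, hζe⟩ := csInf_mem hne
  have hle : (ζ : WithTop Ordinal.{u}) ≤ ξ := hζe.trans_le h
  exact eq_empty_of_subset_empty
    ((iter_antitone (derivation_subset ε) (WithTop.coe_le_coe.1 hle)).trans hζ.subset)

theorem index_le_iff {ξ : Ordinal.{u}} :
    index L ≤ (ξ : WithTop Ordinal.{u}) ↔ ∀ ε : ℝ, 0 < ε → iter (derivation ε) L ξ = ∅ := by
  simp only [index, iSup_le_iff, indexEps_le_iff]

theorem lt_index_iff {ξ : Ordinal.{u}} :
    (ξ : WithTop Ordinal.{u}) < index L ↔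
      ∃ ε : ℝ, 0 < ε ∧ (iter (derivation ε) L ξ).Nonempty := by
  rw [← not_le, index_le_iff]
  push Not
  rfl

/-- If `x` survives `ξ` derivations of a convex set `L` at scale `ε`, then the half-size copy
`(L + x) / 2` of `L` survives `ξ` derivations at scale `ε / 2`, and can be derived `ξ` times
more. -/
theorem iter_add_self_nonempty {ε : ℝ} (hL : ∀ x ∈ L, ∀ y ∈ L, (2⁻¹ : 𝕜) • (x + y) ∈ L)
    {ξ : Ordinal.{u}} (h : (iter (derivation ε) L ξ).Nonempty) :
    (iter (derivation (2⁻¹ * ε)) L (ξ + ξ)).Nonempty := by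
  have hmid : ∀ y : StrongDual 𝕜 X, ∀ S S' : Set (StrongDual 𝕜 X),
      MapsTo (fun z => (2⁻¹ : 𝕜) • (z + y)) S S' →
      MapsTo (fun z => (2⁻¹ : 𝕜) • (z + y)) (iter (derivation ε) S ξ)
        (iter (derivation (2⁻¹ * ε)) S' ξ) := fun y S S' hS => by
    refine iterDerivation_mapsTo
      (T' := fun z => (2⁻¹ : 𝕜) • (z + StrongDual.toWeakDual y)) (fun z => by simp)
      (by fun_prop) (by norm_num) (fun z w => ?_) hS ε ξ
    have : (2⁻¹ : 𝕜) • (z + y) - (2⁻¹ : 𝕜) • (w + y) = (2⁻¹ : 𝕜) • (z - w) :=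
      ContinuousLinearMap.ext fun v => by
        simp only [_root_.sub_apply, _root_.smul_apply, _root_.add_apply, smul_eq_mul]
        ring
    rw [dist_eq_norm, dist_eq_norm]
    refine le_of_eq (.trans ?_ (congrArg norm this).symm)
    rw [norm_smul, norm_inv, RCLike.norm_ofNat]
  obtain ⟨x, hx⟩ := h
  have hmem : ∀ z ∈ L, (2⁻¹ : 𝕜) • (z + x) ∈ iter (derivation (2⁻¹ * ε)) L ξ := fun z hz => by
    have := hmid z L L (fun w hw => hL w hw z hz) hx
    rwa [add_comm z x]
  rw [iter_add (derivation_subset _)]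
  exact ⟨_, hmid x L _ hmem hx⟩

/-- The Szlenk index of a convex set is additively principal. -/
theorem exists_index_eq_opow (hL : ∀ x ∈ L, ∀ y ∈ L, (2⁻¹ : 𝕜) • (x + y) ∈ L)
    (hne : L.Nonempty) {σ : Ordinal.{u}} (hσ : index L = (σ : WithTop Ordinal.{u})) :
    ∃ a : Ordinal.{u}, σ = ω ^ a := by
  have hdouble : ∀ c < σ, c + c < σ := by
    intro c hc
    rw [← WithTop.coe_lt_coe, ← hσ] at hc ⊢
    obtain ⟨ε, hε, h⟩ := lt_index_iff.1 hc
    exact lt_index_iff.2 ⟨2⁻¹ * ε, by positivity, iter_add_self_nonempty hL h⟩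
  have hprin : Ordinal.IsPrincipal (· + ·) σ := fun a b ha hb =>
    (add_le_add (le_max_left a b) (le_max_right a b)).trans_lt (hdouble _ (max_lt ha hb))
  rcases Ordinal.isPrincipal_add_iff_zero_or_omega0_opow.1 hprin with rfl | ⟨a, ha⟩
  · have := index_le_iff.1 hσ.le 1 one_pos
    rw [iter_zero] at this
    exact absurd this hne.ne_empty
  · exact ⟨a, ha.symm⟩

/-- A weak-star compact set is fragmentable exactly when its Szlenk derivations terminate at every
scale. -/
theorem isFragmentable_iff (hL : IsCompact (StrongDual.toWeakDual '' L)) :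
    IsFragmentable L ↔ index L ≠ ⊤ := by
  constructor
  · intro h
    have hterm : ∀ ε : ℝ, 0 < ε → ∃ ξ : Ordinal.{u}, iter (derivation ε) L ξ = ∅ := by
      intro ε hε
      by_contra! hcon
      refine not_injective_of_ordinal (fun ξ : Ordinal.{u} => iter (derivation ε) L ξ) ?_
      have hstep : ∀ ξ : Ordinal.{u},
          iter (derivation ε) L (ξ + 1) ⊂ iter (derivation ε) L ξ := by
        intro ξ
        rw [iter_add_one]
        refine h ε hε _ (iter_subset (derivation_subset ε) ξ) (hcon ξ) ?_
        refine hL.of_isClosed_subset ?_ (image_mono (iter_subset (derivation_subset ε) ξ))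
        have := level_isClosed hL ε ξ
        rw [level_eq, ← LinearEquiv.image_symm_eq_preimage] at this
        exact this
      refine StrictAnti.injective fun ξ ζ hξζ => ?_
      exact (iter_antitone (derivation_subset ε) (Order.add_one_le_of_lt hξζ)).trans_ssubset
        (hstep ξ)
    choose f hf using fun ε : {ε : ℝ // 0 < ε} => hterm ε.1 ε.2
    obtain ⟨ξ, hξ⟩ := Ordinal.bddAbove_of_small (s := range f)
    have : index L ≤ (ξ : WithTop Ordinal.{u}) := index_le_iff.2 fun ε hε =>
      eq_empty_of_subset_empty ((iter_antitone (derivation_subset ε)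
        (hξ (mem_range_self ⟨ε, hε⟩))).trans (hf ⟨ε, hε⟩).subset)
    exact (this.trans_lt (WithTop.coe_lt_top ξ)).ne
  · intro h ε hε M hML hM _
    refine ⟨derivation_subset ε M, fun hsub => hM.ne_empty ?_⟩
    obtain ⟨σ, hσ⟩ := WithTop.ne_top_iff_exists.1 h
    have hall : ∀ ξ : Ordinal.{u}, M ⊆ iter (derivation ε) M ξ := by
      intro ξ
      induction ξ using Ordinal.limitRecOn with
      | zero => simp
      | add_one ξ ih =>
        rw [iter_add_one]
        exact hsub.trans (derivation_mono ε ih)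
      | limit ξ hξ ih =>
        rw [iter_limit _ _ hξ]
        exact subset_iInter₂ ih
    exact eq_empty_of_subset_empty ((hall σ).trans ((iter_mono (derivation_mono ε) hML σ).trans
      (index_le_iff.1 hσ.ge ε hε).subset))

end Index

/-! ### The lower estimate -/

section Mean

variable {𝕜 : Type} [RCLike 𝕜] {X : Type u} [NormedAddCommGroup X] [NormedSpace 𝕜 X]
  {Y : Type v} [NormedAddCommGroup Y] [NormedSpace 𝕜 Y] {p : ℝ≥0∞} [Fact (1 ≤ p)]

theorem integrable_coe (f : LpSpace p X) : Integrable f (volume : Measure unitInterval) :=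
  (Lp.memLp f).integrable Fact.out

theorem norm_integral_le_norm [NormedSpace ℝ X] (f : LpSpace p X) :
    ‖∫ t : unitInterval, f t‖ ≤ ‖f‖ := by
  refine (norm_integral_le_integral_norm _).trans ?_
  rw [integral_norm_eq_lintegral_enorm (integrable_coe f).1, ← eLpNorm_one_eq_lintegral_enorm,
    Lp.norm_def]
  exact ENNReal.toReal_mono (Lp.eLpNorm_ne_top f)
    (eLpNorm_le_eLpNorm_of_exponent_le Fact.out (Lp.aestronglyMeasurable f))

variable (𝕜 X p) in
/-- The mean of a Bochner function, as an operator of norm at most `1` on `L_p(X)`. -/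
noncomputable def mean : LpSpace p X →L[𝕜] X :=
  letI : NormedSpace ℝ X := NormedSpace.restrictScalars ℝ 𝕜 X
  LinearMap.mkContinuous
    { toFun := fun f => ∫ t, f t
      map_add' := fun f g => by
        rw [integral_congr_ae (Lp.coeFn_add f g)]
        exact integral_add (integrable_coe f) (integrable_coe g)
      map_smul' := fun c f => by
        rw [integral_congr_ae (Lp.coeFn_smul c f)]
        exact integral_smul c f } 1 fun f => by
      rw [one_mul]
      exact norm_integral_le_norm f

theorem norm_mean_le : ‖mean 𝕜 X p‖ ≤ 1 := LinearMap.mkContinuous_norm_le _ zero_le_one _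

theorem mean_const [CompleteSpace X] (x : X) : mean 𝕜 X p (Lp.const p volume x) = x := by
  let : NormedSpace ℝ X := NormedSpace.restrictScalars ℝ 𝕜 X
  change ∫ t, (Lp.const p (volume : Measure unitInterval) x) t = x
  rw [integral_congr_ae (Lp.coeFn_const p volume x)]
  simp

theorem mean_pointwiseOp [CompleteSpace X] [CompleteSpace Y] (A : X →L[𝕜] Y) :
    (mean 𝕜 Y p).comp (pointwiseOp p A) = A.comp (mean 𝕜 X p) := by
  let : NormedSpace ℝ X := NormedSpace.restrictScalars ℝ 𝕜 X
  let : NormedSpace ℝ Y := NormedSpace.restrictScalars ℝ 𝕜 Y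
  ext f
  change ∫ t, (pointwiseOp p A f) t = A (∫ t, f t)
  rw [← A.integral_comp_comm (integrable_coe f)]
  exact integral_congr_ae (A.coeFn_compLpL f)

theorem norm_le_norm_comp_mean [CompleteSpace X] (z : StrongDual 𝕜 X) :
    ‖z‖ ≤ ‖z.comp (mean 𝕜 X p)‖ := by
  refine z.opNorm_le_bound (norm_nonneg _) fun x => ?_
  have h := (z.comp (mean 𝕜 X p)).le_opNorm (Lp.const p volume x)
  rw [ContinuousLinearMap.comp_apply, mean_const] at h
  refine h.trans (mul_le_mul_of_nonneg_left ?_ (norm_nonneg _))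
  refine (Lp.norm_const_le (p := p) (μ := (volume : Measure unitInterval)) (c := x)).trans ?_
  simp

/-- Composition with the mean is weak-star continuous, does not shrink distances, and maps
`A^* B` into `A_p^* B`. -/
theorem opIndex_le_opIndex_pointwiseOp [CompleteSpace X] [CompleteSpace Y] (A : X →L[𝕜] Y) :
    opIndex A ≤ opIndex (pointwiseOp p A) := by
  rcases eq_or_ne (opIndex (pointwiseOp p A)) ⊤ with h | h
  · exact h ▸ le_top
  obtain ⟨σ, hσ⟩ := WithTop.ne_top_iff_exists.1 h
  rw [← hσ]
  refine index_le_iff.2 fun ε hε => eq_empty_of_forall_notMem fun x hx => ?_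
  have hmaps : MapsTo (fun z : StrongDual 𝕜 X => z.comp (mean 𝕜 X p)) (adjointBall A)
      (adjointBall (pointwiseOp p A)) := by
    intro z hz
    obtain ⟨y, hy, rfl⟩ := mem_adjointBall.1 hz
    refine mem_adjointBall.2 ⟨y.comp (mean 𝕜 Y p), ?_, ?_⟩
    · exact (y.opNorm_comp_le _).trans (mul_le_one₀ hy (norm_nonneg _) norm_mean_le)
    · rw [ContinuousLinearMap.comp_assoc, mean_pointwiseOp, ← ContinuousLinearMap.comp_assoc]
  have hcont : Continuous fun z : WeakDual 𝕜 X =>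
      StrongDual.toWeakDual ((WeakDual.toStrongDual z).comp (mean 𝕜 X p)) :=
    WeakDual.continuous_of_continuous_eval fun f => WeakDual.eval_continuous (mean 𝕜 X p f)
  have := iterDerivation_mapsTo (T := fun z => z.comp (mean 𝕜 X p)) (fun _ => rfl) hcont one_pos
    (fun z w => by
      rw [one_mul, dist_eq_norm, dist_eq_norm, ← ContinuousLinearMap.sub_comp]
      exact norm_le_norm_comp_mean _) hmaps ε σ hx
  rw [one_mul, index_le_iff.1 hσ.ge ε hε] at this
  exact this

end Mean

/-! ### The index of the pointwise operator -/

section Operators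

variable {𝕜 : Type} [RCLike 𝕜] {X : Type u} [NormedAddCommGroup X] [NormedSpace 𝕜 X]
  {Y : Type v} [NormedAddCommGroup Y] [NormedSpace 𝕜 Y]

theorem midpoint_mem_adjointBall (A : X →L[𝕜] Y) :
    ∀ x ∈ adjointBall A, ∀ y ∈ adjointBall A, (2⁻¹ : 𝕜) • (x + y) ∈ adjointBall A := by
  intro x hx y hy
  obtain ⟨f, hf, rfl⟩ := mem_adjointBall.1 hx
  obtain ⟨g, hg, rfl⟩ := mem_adjointBall.1 hy
  refine mem_adjointBall.2 ⟨(2⁻¹ : 𝕜) • (f + g), ?_, rfl⟩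
  rw [norm_smul, norm_inv, RCLike.norm_ofNat]
  have := norm_add_le f g
  linarith

theorem exists_opIndex_eq_opow (A : X →L[𝕜] Y) (h : opIndex A ≠ ⊤) :
    ∃ a : Ordinal.{u}, opIndex A = ((ω ^ a : Ordinal.{u}) : WithTop Ordinal.{u}) := by
  obtain ⟨σ, hσ⟩ := WithTop.ne_top_iff_exists.1 h
  obtain ⟨a, rfl⟩ := exists_index_eq_opow (midpoint_mem_adjointBall A)
    ⟨0, mem_adjointBall.2 ⟨0, by simp, by simp⟩⟩ hσ.symm
  exact ⟨a, hσ.symm⟩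

theorem isAsplund_iff (A : X →L[𝕜] Y) : IsAsplund A ↔ opIndex A ≠ ⊤ :=
  isFragmentable_iff (isCompact_adjointBall A)

variable {p : ℝ≥0∞} [Fact (1 ≤ p)]

theorem opIndex_pointwiseOp_le (hp : 1 < p) (hp' : p < ∞) (A : X →L[𝕜] Y) :
    opIndex (pointwiseOp p A) ≤ omegaMul (opIndex A) := by
  rcases eq_or_ne (opIndex A) ⊤ with h | h
  · rw [h]
    exact le_top
  obtain ⟨a, ha⟩ := exists_opIndex_eq_opow A h
  rw [ha]
  exact index_le_iff.2 fun ε hε =>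
    iter_adjointBall_pointwiseOp hp hp' A (index_le_iff.1 ha.le) hε

theorem pointwiseOp_index [CompleteSpace X] [CompleteSpace Y] (hp : 1 < p) (hp' : p < ∞)
    (A : X →L[𝕜] Y) :
    opIndex (pointwiseOp p A) ≤ omegaMul (opIndex A) ∧
      (((ω ^ ω : Ordinal.{u}) : WithTop Ordinal.{u}) ≤ opIndex A →
        opIndex (pointwiseOp p A) = opIndex A) ∧
      (IsAsplund (pointwiseOp p A) ↔ IsAsplund A) := by
  have hle := opIndex_pointwiseOp_le hp hp' A
  have hge := opIndex_le_opIndex_pointwiseOp (p := p) A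
  refine ⟨hle, fun hω => le_antisymm ?_ hge, ?_⟩
  · rcases eq_or_ne (opIndex A) ⊤ with h | h
    · exact h ▸ le_top
    obtain ⟨a, ha⟩ := exists_opIndex_eq_opow A h
    rw [ha] at hω hle ⊢
    refine hle.trans_eq (congrArg WithTop.some ?_)
    -- `ω ≤ a` gives `1 + a = a`.
    have : ω ≤ a := (Ordinal.opow_le_opow_iff_right Ordinal.one_lt_omega0).1
      (WithTop.coe_le_coe.1 hω)
    calc ω * ω ^ a = ω ^ (1 + a) := by rw [Ordinal.opow_add, Ordinal.opow_one]
      _ = ω ^ a := by rw [Ordinal.one_add_of_omega0_le this]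
  · rw [isAsplund_iff, isAsplund_iff]
    refine not_congr ⟨fun h => ?_, fun h => top_le_iff.1 (h.symm.trans_le hge)⟩
    by_contra hA
    obtain ⟨σ, hσ⟩ := WithTop.ne_top_iff_exists.1 hA
    rw [← hσ, h] at hle
    exact WithTop.coe_ne_top (top_le_iff.1 hle)

theorem pointwiseOp_id :
    pointwiseOp p (ContinuousLinearMap.id 𝕜 X) = ContinuousLinearMap.id 𝕜 (LpSpace p X) :=
  ContinuousLinearMap.ext fun f => Lp.ext ((ContinuousLinearMap.id 𝕜 X).coeFn_compLpL f)

end Operators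

end Szlenk

theorem corollary2 {𝕜 : Type} [RCLike 𝕜]
    {X : Type u} [NormedAddCommGroup X] [NormedSpace 𝕜 X] [CompleteSpace X]
    {Y : Type v} [NormedAddCommGroup Y] [NormedSpace 𝕜 Y] [CompleteSpace Y]
    (p : ℝ≥0∞) [Fact (1 ≤ p)] (hp : 1 < p) (hp' : p < ∞) (A : X →L[𝕜] Y) :
    (Szlenk.opIndex (Szlenk.pointwiseOp p A) ≤ Szlenk.omegaMul (Szlenk.opIndex A) ∧
      (((ω ^ ω : Ordinal.{u}) : WithTop Ordinal.{u}) ≤ Szlenk.opIndex A →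
        Szlenk.opIndex (Szlenk.pointwiseOp p A) = Szlenk.opIndex A) ∧
      (Szlenk.IsAsplund (Szlenk.pointwiseOp p A) ↔ Szlenk.IsAsplund A)) ∧
    (Szlenk.spaceIndex 𝕜 (Szlenk.LpSpace p X) ≤ Szlenk.omegaMul (Szlenk.spaceIndex 𝕜 X) ∧
      (((ω ^ ω : Ordinal.{u}) : WithTop Ordinal.{u}) ≤ Szlenk.spaceIndex 𝕜 X →
        Szlenk.spaceIndex 𝕜 (Szlenk.LpSpace p X) = Szlenk.spaceIndex 𝕜 X)) := by
  refine ⟨Szlenk.pointwiseOp_index hp hp' A, ?_⟩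
  obtain ⟨h1, h2, -⟩ := Szlenk.pointwiseOp_index hp hp' (ContinuousLinearMap.id 𝕜 X)
  rw [Szlenk.pointwiseOp_id] at h1 h2
  exact ⟨h1, h2⟩
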